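/- **Theorem 3.1.** Let $(X,\Sigma,\mu)$ be a measure space and $\mathcal A\subseteq\Sigma$ a sub-$\sigma$-algebra such that $\mu|_{\mathcal A}$ is $\sigma$-finite, and let $E=E^{\mathcal A}$ be the conditional expectation: for measurable $g\ge 0$, $E(g)$ is the $\mathcal A$-measurable $[0,\infty]$-valued function with $\int_A E(g)\,d\mu=\int_A g\,d\mu$ for all $A\in\mathcal A$. A measurable $g:X\to\mathbb C$ is *conditionable* if $E(|g|)<\infty$ a.e., and then $E(g)$ is defined through the positive and negative parts of $\operatorname{Re} g$ and $\operatorname{Im} g$. Let $w,u:X\to\mathbb C$ be conditionable, and let $T=M_wEM_u$ be the weighted conditional type operator in $L^2(\mu)=L^2(X,\Sigma,\mu)$ with $$\mathcal D(T)=\{f\in L^2(\mu):\ uf \text{ is conditionable and } wE(uf)\in L^2(\mu)\},\qquad Tf=wE(uf).$$ Suppose that $T$ is densely defined and closed. Then $E(|w|^2)E(|u|^2)<\infty$ a.e.; for $\lambda>0$ put $$t_\lambda=\frac1{\lambda+E(|w|^2)E(|u|^2)},\qquad P_\lambda=(\lambda I+T^*T)^{-1},\qquad Q_\lambda=(\lambda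 I+TT^*)^{-1},$$ where $\lambda I+T^*T$ and $\lambda I+TT^*$ are bijections from their natural domains onto $L^2(\mu)$. For $f\in L^2(\mu)$ write $M_{t_\lambda}T^*(f)=t_\lambda\,\bar u\,E(\bar w f)$; this lies in $L^2(\mu)$, and it equals $t_\lambda\cdot T^*f$ if $f\in\mathcal D(T^*)$. (At points where $u=0$ the expression $\bar u\,E(\bar w f)$ is read as $0$.) 1. For every $f\in L^2(\mu)$ and $\lambda>0$ the Tikhonov functional $F(v)=\|Tv-f\|^2+\lambda\|v\|^2$, $v\in\mathcal D(T)$, has the unique global minimizer $u_\lambda=M_{t_\lambda}T^*(f)$. Moreover $T^*Q_\lambda f=M_{t_\lambda}T^*(f)$, and $P_\lambda T^*f=M_{t_\lambda}T^*(f)$ if $f\in\mathcal D(T^*)$. 2. There is exactly one Moore–Penrose inverse $T^\dagger$ of $T$, that is, a closed densely defined operator with $\mathcal D(T^\dagger)=\mathcal R(T)\oplus\mathcal R(T)^\perp$, $TT^\dagger y=P_{\overline{\mathcal R(T)}}\,y$ for $y\in\mathcal D(T^\dagger)$, $T^\dagger Tx=P_{\mathcal N(T)^\perp}\,x$ for $x\in\mathcal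 D(T)$, and $\mathcal N(T^\dagger)=\mathcal R(T)^\perp$. 3. If $f\in\mathcal R(T)$, then $Tv=f$ has a unique solution $y$ of minimal norm, $\lim_{\lambda\to0^+}\|u_\lambda-y\|=0$, and $y=T^\dagger f$. -/

import Mathlib

open MeasureTheory Filter Topology
open scoped ENNReal ComplexConjugate

noncomputable section

namespace WCT

section CondExp

variable {X : Type*} {m m0 : MeasurableSpace X}

/-- Conditional expectation of a real function, `E(f) = E(f⁺) - E(f⁻)`, where on nonnegative
functions `E` is the (Radon-Nikodym) conditional expectation with values in `[0, ∞]`.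
It is meaningful as soon as `E(|f|) < ∞` a.e.; integrability of `f` is not needed. -/
def condERe (m : MeasurableSpace X) {m0 : MeasurableSpace X} (μ : Measure[m0] X) (f : X → ℝ) :
    X → ℝ := fun x =>
  (condLExp m μ (fun y => ENNReal.ofReal (f y)) x).toReal
    - (condLExp m μ (fun y => ENNReal.ofReal (-f y)) x).toReal

/-- Conditional expectation of a complex function, by real and imaginary parts. -/
def condE (m : MeasurableSpace X) {m0 : MeasurableSpace X} (μ : Measure[m0] X) (f : X → ℂ) :
    X → ℂ := fun x =>
  (condERe m μ (fun y => (f y).re) x : ℂ) + (condERe m μ (fun y => (f y).im) x : ℂ) * Complex.I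

/-- `f` is conditionable: `E(|f|) < ∞` almost everywhere. -/
def Conditionable (m : MeasurableSpace X) {m0 : MeasurableSpace X} (μ : Measure[m0] X)
    (f : X → ℂ) : Prop :=
  ∀ᵐ x ∂μ, condLExp m μ (fun y => ‖f y‖ₑ) x < ∞

/-- `E(|f|²)`, with values in `[0, ∞]`. -/
def condSq (m : MeasurableSpace X) {m0 : MeasurableSpace X} (μ : Measure[m0] X)
    (f : X → ℂ) : X → ℝ≥0∞ :=
  condLExp m μ (fun y => ‖f y‖ₑ ^ 2)

variable {μ : Measure[m0] X}

lemma condERe_eq_sub {f : X → ℝ} {a b : X → ℝ≥0∞} (hf : AEMeasurable[m0] f μ)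
    (ha : AEMeasurable[m0] a μ) (hb : AEMeasurable[m0] b μ)
    (hEa : ∀ᵐ x ∂μ, condLExp m μ a x < ∞) (hEb : ∀ᵐ x ∂μ, condLExp m μ b x < ∞)
    (h : ∀ x, ENNReal.ofReal (f x) + b x = ENNReal.ofReal (-f x) + a x)
    (hfa : ∀ x, ENNReal.ofReal (f x) ≤ a x) (hfb : ∀ x, ENNReal.ofReal (-f x) ≤ b x) :
    condERe m μ f =ᵐ[μ] fun x => (condLExp m μ a x).toReal - (condLExp m μ b x).toReal := by
  have h1 := condLExp_add_left (mΩ := m) (P := μ) (X := fun x => ENNReal.ofReal (f x)) b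
    hf.ennreal_ofReal
  have h2 := condLExp_add_left (mΩ := m) (P := μ) (X := fun x => ENNReal.ofReal (-f x)) a
    hf.neg.ennreal_ofReal
  have h3 : ((fun x => ENNReal.ofReal (f x)) + b) = ((fun x => ENNReal.ofReal (-f x)) + a) :=
    funext h
  rw [h3] at h1
  have h4 := condLExp_mono (mΩ := m) (P := μ) (ae_of_all μ hfa)
  have h5 := condLExp_mono (mΩ := m) (P := μ) (ae_of_all μ hfb)
  filter_upwards [h1, h2, h4, h5, hEa, hEb] with x h1 h2 h4 h5 ha hb
  have e := h1.symm.trans h2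
  simp only [Pi.add_apply] at e
  have e' := congrArg ENNReal.toReal e
  rw [ENNReal.toReal_add (h4.trans_lt ha).ne hb.ne,
    ENNReal.toReal_add (h5.trans_lt hb).ne ha.ne] at e'
  simp only [condERe]
  linarith

lemma lt_top_of_le {a b : X → ℝ≥0∞} (hb : ∀ᵐ x ∂μ, condLExp m μ b x < ∞)
    (h : ∀ x, a x ≤ b x) : ∀ᵐ x ∂μ, condLExp m μ a x < ∞ := by
  filter_upwards [hb, condLExp_mono (mΩ := m) (P := μ) (ae_of_all μ h)] with x h1 h2
  exact h2.trans_lt h1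

lemma ofReal_le_enorm (r : ℝ) : ENNReal.ofReal r ≤ ‖r‖ₑ := by
  rw [← ofReal_norm]
  exact ENNReal.ofReal_le_ofReal (le_abs_self r)

lemma ofReal_neg_le_enorm (r : ℝ) : ENNReal.ofReal (-r) ≤ ‖r‖ₑ := by
  rw [← ofReal_norm]
  exact ENNReal.ofReal_le_ofReal (neg_le_abs r)

lemma condERe_add {f g : X → ℝ} (hf : AEMeasurable[m0] f μ) (hg : AEMeasurable[m0] g μ)
    (hEf : ∀ᵐ x ∂μ, condLExp m μ (fun y => ‖f y‖ₑ) x < ∞)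
    (hEg : ∀ᵐ x ∂μ, condLExp m μ (fun y => ‖g y‖ₑ) x < ∞) :
    condERe m μ (fun x => f x + g x) =ᵐ[μ] fun x => condERe m μ f x + condERe m μ g x := by
  have f1 := lt_top_of_le hEf fun x => ofReal_le_enorm (f x)
  have f2 := lt_top_of_le hEf fun x => ofReal_neg_le_enorm (f x)
  have g1 := lt_top_of_le hEg fun x => ofReal_le_enorm (g x)
  have g2 := lt_top_of_le hEg fun x => ofReal_neg_le_enorm (g x)
  have ea := condLExp_add_left (mΩ := m) (P := μ) (X := fun x => ENNReal.ofReal (f x))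
    (fun x => ENNReal.ofReal (g x)) hf.ennreal_ofReal
  have eb := condLExp_add_left (mΩ := m) (P := μ) (X := fun x => ENNReal.ofReal (-f x))
    (fun x => ENNReal.ofReal (-g x)) hf.neg.ennreal_ofReal
  have key := condERe_eq_sub (m := m) (μ := μ) (f := fun x => f x + g x)
    (a := (fun x => ENNReal.ofReal (f x)) + (fun x => ENNReal.ofReal (g x)))
    (b := (fun x => ENNReal.ofReal (-f x)) + (fun x => ENNReal.ofReal (-g x)))
    (hf.add hg) (hf.ennreal_ofReal.add hg.ennreal_ofReal)
    (hf.neg.ennreal_ofReal.add hg.neg.ennreal_ofReal)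
    (by filter_upwards [ea, f1, g1] with x e h1 h2
        rw [e]; exact ENNReal.add_lt_top.2 ⟨h1, h2⟩)
    (by filter_upwards [eb, f2, g2] with x e h1 h2
        rw [e]; exact ENNReal.add_lt_top.2 ⟨h1, h2⟩)
    (fun x => by
      simp only [Pi.add_apply]
      rw [← ENNReal.toReal_eq_toReal_iff' (by finiteness) (by finiteness)]
      repeat rw [ENNReal.toReal_add (by finiteness) (by finiteness)]
      simp only [ENNReal.toReal_ofReal']
      have t := fun r : ℝ => max_zero_sub_max_neg_zero_eq_self r
      linarith [t (f x), t (g x), t (f x + g x)])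
    (fun x => ENNReal.ofReal_add_le)
    (fun x => by rw [neg_add]; exact ENNReal.ofReal_add_le)
  filter_upwards [key, ea, eb, f1, f2, g1, g2] with x k ea eb f1 f2 g1 g2
  rw [k, ea, eb, Pi.add_apply, Pi.add_apply, ENNReal.toReal_add f1.ne g1.ne,
    ENNReal.toReal_add f2.ne g2.ne]
  simp only [condERe]
  ring

lemma condERe_const_mul {f : X → ℝ} (c : ℝ) (hf : AEMeasurable[m0] f μ)
    (hEf : ∀ᵐ x ∂μ, condLExp m μ (fun y => ‖f y‖ₑ) x < ∞) :
    condERe m μ (fun x => c * f x) =ᵐ[μ] fun x => c * condERe m μ f x := by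
  have f1 := lt_top_of_le hEf fun x => ofReal_le_enorm (f x)
  have f2 := lt_top_of_le hEf fun x => ofReal_neg_le_enorm (f x)
  have s : ∀ r : ℝ, ∀ᵐ x ∂μ, condLExp m μ (fun x => ENNReal.ofReal r * ENNReal.ofReal (f x)) x
      = ENNReal.ofReal r * condLExp m μ (fun x => ENNReal.ofReal (f x)) x := fun r =>
    condLExp_smul (mΩ := m) (P := μ) _ hf.ennreal_ofReal (ENNReal.ofReal r)
  have s' : ∀ r : ℝ, ∀ᵐ x ∂μ, condLExp m μ (fun x => ENNReal.ofReal r * ENNReal.ofReal (-f x)) x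
      = ENNReal.ofReal r * condLExp m μ (fun x => ENNReal.ofReal (-f x)) x := fun r =>
    condLExp_smul (mΩ := m) (P := μ) _ hf.neg.ennreal_ofReal (ENNReal.ofReal r)
  have ea := condLExp_add_left (mΩ := m) (P := μ)
    (X := fun x => ENNReal.ofReal c * ENNReal.ofReal (f x))
    (fun x => ENNReal.ofReal (-c) * ENNReal.ofReal (-f x)) (hf.ennreal_ofReal.const_mul _)
  have eb := condLExp_add_left (mΩ := m) (P := μ)
    (X := fun x => ENNReal.ofReal c * ENNReal.ofReal (-f x))
    (fun x => ENNReal.ofReal (-c) * ENNReal.ofReal (f x)) (hf.neg.ennreal_ofReal.const_mul _)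
  have le : ∀ a b : ℝ, ENNReal.ofReal (a * b) ≤ ENNReal.ofReal a * ENNReal.ofReal b
      + ENNReal.ofReal (-a) * ENNReal.ofReal (-b) := fun a b => by
    rcases le_total 0 a with h | h
    · rw [ENNReal.ofReal_mul h]; exact le_self_add
    · rw [← neg_mul_neg, ENNReal.ofReal_mul (neg_nonneg.2 h)]; exact le_add_self
  have key := condERe_eq_sub (m := m) (μ := μ) (f := fun x => c * f x)
    (a := (fun x => ENNReal.ofReal c * ENNReal.ofReal (f x))
      + (fun x => ENNReal.ofReal (-c) * ENNReal.ofReal (-f x)))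
    (b := (fun x => ENNReal.ofReal c * ENNReal.ofReal (-f x))
      + (fun x => ENNReal.ofReal (-c) * ENNReal.ofReal (f x)))
    (hf.const_mul c)
    ((hf.ennreal_ofReal.const_mul _).add (hf.neg.ennreal_ofReal.const_mul _))
    ((hf.neg.ennreal_ofReal.const_mul _).add (hf.ennreal_ofReal.const_mul _))
    (by filter_upwards [ea, f1, f2, s c, s' (-c)] with x e h1 h2 h3 h4
        rw [e, Pi.add_apply, h3, h4]
        exact ENNReal.add_lt_top.2 ⟨ENNReal.mul_lt_top (by finiteness) h1,
          ENNReal.mul_lt_top (by finiteness) h2⟩)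
    (by filter_upwards [eb, f1, f2, s (-c), s' c] with x e h1 h2 h3 h4
        rw [e, Pi.add_apply, h3, h4]
        exact ENNReal.add_lt_top.2 ⟨ENNReal.mul_lt_top (by finiteness) h2,
          ENNReal.mul_lt_top (by finiteness) h1⟩)
    (fun x => by
      simp only [Pi.add_apply]
      rw [← ENNReal.toReal_eq_toReal_iff' (by finiteness) (by finiteness)]
      repeat rw [ENNReal.toReal_add (by finiteness) (by finiteness)]
      simp only [ENNReal.toReal_mul, ENNReal.toReal_ofReal']
      have t := fun r : ℝ => max_zero_sub_max_neg_zero_eq_self r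
      have h1 := t (c * f x)
      have h2 : (max c 0 - max (-c) 0) * (max (f x) 0 - max (-f x) 0) = c * f x := by
        rw [t, t]
      linarith)
    (fun x => le c (f x))
    (fun x => by
      have := le c (-f x)
      rwa [neg_neg, mul_neg] at this)
  filter_upwards [key, ea, eb, f1, f2, s c, s (-c), s' c, s' (-c)]
    with x k ea eb f1 f2 h1 h2 h3 h4
  rw [k, ea, eb, Pi.add_apply, Pi.add_apply, h1, h2, h3, h4,
    ENNReal.toReal_add (by finiteness) (by finiteness),
    ENNReal.toReal_add (by finiteness) (by finiteness)]
  simp only [ENNReal.toReal_mul, ENNReal.toReal_ofReal', condERe]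
  have hc := max_zero_sub_max_neg_zero_eq_self c
  linear_combination ((condLExp m μ (fun y => ENNReal.ofReal (f y)) x).toReal
    - (condLExp m μ (fun y => ENNReal.ofReal (-f y)) x).toReal) * hc

lemma Conditionable.re {f : X → ℂ} (h : Conditionable m μ f) :
    ∀ᵐ x ∂μ, condLExp m μ (fun y => ‖(f y).re‖ₑ) x < ∞ :=
  lt_top_of_le h fun x => by
    rw [enorm_le_iff_norm_le]; exact Complex.abs_re_le_norm _

lemma Conditionable.im {f : X → ℂ} (h : Conditionable m μ f) :
    ∀ᵐ x ∂μ, condLExp m μ (fun y => ‖(f y).im‖ₑ) x < ∞ :=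
  lt_top_of_le h fun x => by
    rw [enorm_le_iff_norm_le]; exact Complex.abs_im_le_norm _

lemma conditionable_zero : Conditionable m μ (fun _ => 0) := by
  have : (fun _ : X => ‖(0 : ℂ)‖ₑ) = 0 := by ext; simp
  rw [Conditionable, this, condLExp_zero]
  simp

lemma Conditionable.add {f g : X → ℂ} (hfm : AEMeasurable[m0] f μ)
    (hf : Conditionable m μ f) (hg : Conditionable m μ g) :
    Conditionable m μ (fun x => f x + g x) := by
  have e := condLExp_add_left (mΩ := m) (P := μ) (X := fun x => ‖f x‖ₑ) (fun x => ‖g x‖ₑ)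
    hfm.enorm
  refine lt_top_of_le (b := (fun x => ‖f x‖ₑ) + fun x => ‖g x‖ₑ) ?_ fun x => enorm_add_le _ _
  filter_upwards [e, hf, hg] with x e h1 h2
  rw [e]
  exact ENNReal.add_lt_top.2 ⟨h1, h2⟩

lemma Conditionable.const_mul {f : X → ℂ} (c : ℂ) (hf : Conditionable m μ f) :
    Conditionable m μ (fun x => c * f x) := by
  have e := condLExp_smul' (mΩ := m) (P := μ) (fun x => ‖f x‖ₑ) (c := ‖c‖ₑ) (by finiteness)
  have e2 : (fun x => ‖c * f x‖ₑ) = ‖c‖ₑ • fun x => ‖f x‖ₑ := by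
    ext x; simp [enorm_mul]
  rw [Conditionable, e2]
  filter_upwards [e, hf] with x e h1
  rw [e]
  exact ENNReal.mul_lt_top (by finiteness) h1

lemma condE_add {f g : X → ℂ} (hfm : AEMeasurable[m0] f μ) (hgm : AEMeasurable[m0] g μ)
    (hf : Conditionable m μ f) (hg : Conditionable m μ g) :
    condE m μ (fun x => f x + g x) =ᵐ[μ] fun x => condE m μ f x + condE m μ g x := by
  have h1 := condERe_add (Complex.measurable_re.comp_aemeasurable hfm)
    (Complex.measurable_re.comp_aemeasurable hgm) hf.re hg.re
  have h2 := condERe_add (Complex.measurable_im.comp_aemeasurable hfm)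
    (Complex.measurable_im.comp_aemeasurable hgm) hf.im hg.im
  filter_upwards [h1, h2] with x h1 h2
  simp only [condE, Complex.add_re, Complex.add_im, Function.comp_def] at h1 h2 ⊢
  rw [h1, h2]
  push_cast
  ring

lemma condE_const_mul {f : X → ℂ} (c : ℂ) (hfm : AEMeasurable[m0] f μ)
    (hf : Conditionable m μ f) :
    condE m μ (fun x => c * f x) =ᵐ[μ] fun x => c * condE m μ f x := by
  have mre := Complex.measurable_re.comp_aemeasurable hfm
  have mim := Complex.measurable_im.comp_aemeasurable hfm
  have fin : ∀ (r : ℝ) (g : X → ℝ), (∀ᵐ x ∂μ, condLExp m μ (fun y => ‖g y‖ₑ) x < ∞) →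
      ∀ᵐ x ∂μ, condLExp m μ (fun y => ‖r * g y‖ₑ) x < ∞ := fun r g hg => by
    have e := condLExp_smul' (mΩ := m) (P := μ) (fun x => ‖g x‖ₑ) (c := ‖r‖ₑ) (by finiteness)
    have e2 : (fun x => ‖r * g x‖ₑ) = ‖r‖ₑ • fun x => ‖g x‖ₑ := by
      ext x; simp [enorm_mul]
    rw [e2]
    filter_upwards [e, hg] with x e h1
    rw [e]
    exact ENNReal.mul_lt_top (by finiteness) h1
  have a1 := condERe_add (m := m) (mre.const_mul c.re) (mim.const_mul (-c.im))
    (fin _ _ hf.re) (fin _ _ hf.im)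
  have a2 := condERe_add (m := m) (mim.const_mul c.re) (mre.const_mul c.im)
    (fin _ _ hf.im) (fin _ _ hf.re)
  have b1 := condERe_const_mul c.re mre hf.re
  have b2 := condERe_const_mul (-c.im) mim hf.im
  have b3 := condERe_const_mul c.re mim hf.im
  have b4 := condERe_const_mul c.im mre hf.re
  have e1 : (fun x => (c * f x).re) = fun x => c.re * (f x).re + -c.im * (f x).im := by
    ext x; rw [Complex.mul_re]; ring
  have e2 : (fun x => (c * f x).im) = fun x => c.re * (f x).im + c.im * (f x).re := by
    ext x; rw [Complex.mul_im]
  filter_upwards [a1, a2, b1, b2, b3, b4] with x a1 a2 b1 b2 b3 b4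
  simp only [Function.comp_def] at a1 a2 b1 b2 b3 b4
  simp only [condE, e1, e2]
  rw [a1, a2, b1, b2, b3, b4]
  apply Complex.ext <;> simp <;> ring

lemma condE_congr {f g : X → ℂ} (h : f =ᵐ[μ] g) : condE m μ f =ᵐ[μ] condE m μ g := by
  have c : ∀ φ : ℂ → ℝ≥0∞, condLExp m μ (fun x => φ (f x)) =ᵐ[μ]
      condLExp m μ (fun x => φ (g x)) := fun φ =>
    condLExp_congr_ae (h.mono fun x hx => by simp only [hx])
  filter_upwards [c fun z => ENNReal.ofReal z.re, c fun z => ENNReal.ofReal (-z.re),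
    c fun z => ENNReal.ofReal z.im, c fun z => ENNReal.ofReal (-z.im)] with x h1 h2 h3 h4
  simp only [condE, condERe, h1, h2, h3, h4]

lemma Conditionable.congr {f g : X → ℂ} (hf : Conditionable m μ f) (h : f =ᵐ[μ] g) :
    Conditionable m μ g := by
  filter_upwards [hf, condLExp_congr_ae (mΩ := m) (P := μ) (X := fun x => ‖f x‖ₑ)
    (Y := fun x => ‖g x‖ₑ) (h.mono fun x hx => by simp only [hx])] with x h1 h2
  rwa [← h2]

lemma mul_add_ae (u : X →ₘ[μ] ℂ) (f g : Lp ℂ 2 μ) :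
    (fun x => u x * (f + g : Lp ℂ 2 μ) x) =ᵐ[μ] fun x => u x * f x + u x * g x := by
  filter_upwards [Lp.coeFn_add f g] with x hx
  rw [hx, Pi.add_apply, mul_add]

lemma mul_smul_ae (u : X →ₘ[μ] ℂ) (c : ℂ) (f : Lp ℂ 2 μ) :
    (fun x => u x * (c • f : Lp ℂ 2 μ) x) =ᵐ[μ] fun x => c * (u x * f x) := by
  filter_upwards [Lp.coeFn_smul c f] with x hx
  rw [hx, Pi.smul_apply, smul_eq_mul, mul_left_comm]

lemma aemeasurable_mul_Lp (u : X →ₘ[μ] ℂ) (f : Lp ℂ 2 μ) :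
    AEMeasurable[m0] (fun x => u x * f x) μ :=
  (u.aestronglyMeasurable.mul (Lp.aestronglyMeasurable f)).aemeasurable

/-- The function `w E(u f)`. -/
def wctFun (m : MeasurableSpace X) {m0 : MeasurableSpace X} (μ : Measure[m0] X)
    (w u : X →ₘ[μ] ℂ) (f : Lp ℂ 2 μ) : X → ℂ :=
  fun x => w x * condE m μ (fun y => u y * f y) x

lemma wctFun_add (w u : X →ₘ[μ] ℂ) {f g : Lp ℂ 2 μ}
    (hf : Conditionable m μ (fun x => u x * f x)) (hg : Conditionable m μ (fun x => u x * g x)) :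
    wctFun m μ w u (f + g) =ᵐ[μ] wctFun m μ w u f + wctFun m μ w u g := by
  filter_upwards [condE_congr (m := m) (mul_add_ae u f g),
    condE_add (aemeasurable_mul_Lp u f) (aemeasurable_mul_Lp u g) hf hg] with x h1 h2
  simp only [wctFun, Pi.add_apply]
  rw [h1, h2, mul_add]

lemma wctFun_smul (w u : X →ₘ[μ] ℂ) (c : ℂ) {f : Lp ℂ 2 μ}
    (hf : Conditionable m μ (fun x => u x * f x)) :
    wctFun m μ w u (c • f) =ᵐ[μ] c • wctFun m μ w u f := by
  filter_upwards [condE_congr (m := m) (mul_smul_ae u c f),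
    condE_const_mul c (aemeasurable_mul_Lp u f) hf] with x h1 h2
  simp only [wctFun, Pi.smul_apply, smul_eq_mul]
  rw [h1, h2, mul_left_comm]

/-- The natural domain `{f ∈ L²(μ) : u f is conditionable and w E(u f) ∈ L²(μ)}`. -/
def wctDomain (m : MeasurableSpace X) {m0 : MeasurableSpace X} (μ : Measure[m0] X)
    (w u : X →ₘ[μ] ℂ) : Submodule ℂ (Lp ℂ 2 μ) where
  carrier := {f | Conditionable m μ (fun x => u x * f x) ∧ MemLp (wctFun m μ w u f) 2 μ}
  zero_mem' := by
    have h0 : Conditionable m μ (fun x => u x * (0 : Lp ℂ 2 μ) x) := by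
      refine conditionable_zero.congr ?_
      filter_upwards [Lp.coeFn_zero ℂ 2 μ] with x hx
      rw [hx, Pi.zero_apply, mul_zero]
    refine ⟨h0, MemLp.ae_eq ?_ (MemLp.zero (ε := ℂ))⟩
    have h := wctFun_smul w u 0 h0
    rw [zero_smul, zero_smul] at h
    exact h.symm
  add_mem' := fun ⟨hf, hf'⟩ ⟨hg, hg'⟩ =>
    ⟨(hf.add (aemeasurable_mul_Lp u _) hg).congr (mul_add_ae u _ _).symm,
      (hf'.add hg').ae_eq (wctFun_add w u hf hg).symm⟩
  smul_mem' := fun c _ ⟨hf, hf'⟩ =>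
    ⟨(hf.const_mul c).congr (mul_smul_ae u c _).symm,
      (hf'.const_smul c).ae_eq (wctFun_smul w u c hf).symm⟩

/-- The weighted conditional type operator `M_w E M_u`, `f ↦ w E(u f)`, as an operator in
`L²(μ)` with its natural domain. The weights are elements of `L⁰(Σ)`. -/
def wct (m : MeasurableSpace X) {m0 : MeasurableSpace X} (μ : Measure[m0] X)
    (w u : X →ₘ[μ] ℂ) : Lp ℂ 2 μ →ₗ.[ℂ] Lp ℂ 2 μ where
  domain := wctDomain m μ w u
  toFun :=
    { toFun := fun f => MemLp.toLp (wctFun m μ w u f) f.2.2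
      map_add' := fun f g =>
        (MemLp.toLp_congr _ (f.2.2.add g.2.2) (wctFun_add w u f.2.1 g.2.1)).trans
          (MemLp.toLp_add f.2.2 g.2.2)
      map_smul' := fun c f =>
        (MemLp.toLp_congr _ (f.2.2.const_smul c) (wctFun_smul w u c f.2.1)).trans
          (MemLp.toLp_const_smul c f.2.2) }

/-- The function `t_λ = 1 / (λ + E(|w|²) E(|u|²))`. -/
def tFun (m : MeasurableSpace X) {m0 : MeasurableSpace X} (μ : Measure[m0] X)
    (w u : X →ₘ[μ] ℂ) (lam : ℝ) : X → ℝ := fun x =>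
  1 / (lam + (condSq m μ w x * condSq m μ u x).toReal)

end CondExp

section Operators

variable {H : Type*} [NormedAddCommGroup H] [InnerProductSpace ℂ H]

/-- Composition of unbounded operators with the natural domain
`D(S T) = {x ∈ D(T) : T x ∈ D(S)}`. -/
def natComp (S T : H →ₗ.[ℂ] H) : H →ₗ.[ℂ] H where
  domain := (S.domain.comap T.toFun).map T.domain.subtype
  toFun :=
    { toFun := fun x => S ⟨T ⟨x, by
          obtain ⟨y, _, hy⟩ := x.2
          rw [← hy]; exact y.2⟩, by
          obtain ⟨x, y, hy, rfl⟩ := x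
          exact hy⟩
      map_add' := by
        intro x y
        rw [← LinearPMap.map_add]
        congr 1
        apply Subtype.ext
        exact LinearPMap.map_add T ⟨x, _⟩ ⟨y, _⟩
      map_smul' := by
        intro c x
        rw [RingHom.id_apply, ← LinearPMap.map_smul]
        congr 1
        apply Subtype.ext
        exact LinearPMap.map_smul T c ⟨x, _⟩ }

/-- The operator `λ I + A`, with domain `D(A)`. -/
def shift (lam : ℝ) (A : H →ₗ.[ℂ] H) : H →ₗ.[ℂ] H :=
  ((lam : ℂ) • (LinearMap.id : H →ₗ[ℂ] H)).toPMap ⊤ + A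

/-- The Tikhonov functional `F(v) = ‖T v - f‖² + λ ‖v‖²` on `D(T)`. -/
def tikhonov (T : H →ₗ.[ℂ] H) (f : H) (lam : ℝ) (v : T.domain) : ℝ :=
  ‖T v - f‖ ^ 2 + lam * ‖(v : H)‖ ^ 2

/-- `x` is the unique global minimizer on `D(T)` of the Tikhonov functional. -/
def IsUniqueMinimizer (T : H →ₗ.[ℂ] H) (f : H) (lam : ℝ) (x : H) : Prop :=
  ∃ hx : x ∈ T.domain, (∀ v : T.domain, tikhonov T f lam ⟨x, hx⟩ ≤ tikhonov T f lam v) ∧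
    ∀ v : T.domain, (∀ v' : T.domain, tikhonov T f lam v ≤ tikhonov T f lam v') → (v : H) = x

/-- `y` is the (unique) solution of `T y = f` of minimal norm. -/
def IsMinimalNormSolution (T : H →ₗ.[ℂ] H) (f y : H) : Prop :=
  (∃ hy : y ∈ T.domain, T ⟨y, hy⟩ = f) ∧
    ∀ v : T.domain, T v = f → ‖y‖ ≤ ‖(v : H)‖ ∧ (‖(v : H)‖ = ‖y‖ → (v : H) = y)

/-- The range of `T`. -/
def ran (T : H →ₗ.[ℂ] H) : Submodule ℂ H := LinearMap.range T.toFun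

/-- The null space of `T`. -/
def nul (T : H →ₗ.[ℂ] H) : Submodule ℂ H := (LinearMap.ker T.toFun).map T.domain.subtype

/-- `S` is the Moore-Penrose inverse of `T`: a closed densely defined operator with
`D(S) = R(T) ⊕ R(T)^⊥`, `T S y` the orthogonal projection of `y` onto the closure of `R(T)` for
`y ∈ D(S)`, `S T x` the orthogonal projection of `x` onto `N(T)^⊥` for `x ∈ D(T)`, and
`N(S) = R(T)^⊥`. -/
structure IsMoorePenrose [CompleteSpace H] (T S : H →ₗ.[ℂ] H) : Prop where
  isClosed : S.IsClosed
  dense : Dense (S.domain : Set H)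
  domain_eq : S.domain = ran T ⊔ (ran T)ᗮ
  right : ∀ y : S.domain, ∃ h : S y ∈ T.domain,
    T ⟨S y, h⟩ = (ran T).topologicalClosure.starProjection (y : H)
  left : ∀ x : T.domain, ∃ h : T x ∈ S.domain,
    S ⟨T x, h⟩ = (nul T)ᗮ.starProjection (x : H)
  nul_eq : nul S = (ran T)ᗮ

end Operators

end WCT

end

noncomputable section

namespace WCT

/-! ### The regularised normal equation of a closed operator in a Hilbert space. -/

section Abstract

variable {H : Type*} [NormedAddCommGroup H] [InnerProductSpace ℂ H]

local notation "⟪" x "," y "⟫" => inner ℂ x y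

/-! For a closed densely defined T everything rests on the weak normal equation `SolvesNormal`,
which `exists_solvesNormal` solves by one orthogonal projection onto a rescaled graph of T. With f =
0 its solution is (λ + T*T)⁻¹g. With g = 0 it is the Tikhonov minimiser, by completing the square
(`SolvesNormal.tikhonov_eq`), and the scaled residual (f - Tx)/λ is (λ + TT*)⁻¹f. So the minimiser,
P_λT*f and T*Q_λf are the same vector for any such T, and only its explicit form involves
conditional expectations.

For T = M_wEM_u, put a = E(uv) and b = E(w̄f). Then ⟪Tv, f⟫ = ∫ ā b. The candidate z = t_λ ū b
satisfies ⟪v, z⟫ = ∫ t_λ ā b and Tz = t_λ E(|u|²) w b, so the left side of the normal equation is ∫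
t_λ (λ + E(|w|²)E(|u|²)) ā b = ∫ ā b. This is `regularised_solves`.

Two analytic points support the computation. Finiteness of E(|w|²)E(|u|²) comes from density and
closedness: u vanishes where E(|w|²) = ∞ (`eq_zero_of_condSq_eq_top`) and w vanishes where E(|u|²) =
∞ (`eq_zero_of_condSq_eq_top_right`). That z and Tz lie in L² comes from the conditional
Cauchy-Schwarz inequality (`condLExp_mul_sq_le`).

The Moore-Penrose inverse is the inverse of T restricted to N(T)^⊥, preceded by the projection onto
the closure of R(T). Convergence as λ → 0 (`tendsto_regularised`) holds because R(T*) is dense in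
N(T)^⊥. -/

lemma graph_mem_iff {T : H →ₗ.[ℂ] H} {x y : H} :
    (x, y) ∈ T.graph ↔ ∃ hx : x ∈ T.domain, T ⟨x, hx⟩ = y := by
  simp [LinearPMap.mem_graph_iff]

/-- The regularised normal equation in weak form,
`λ ⟪v, x⟫ + ⟪T v, T x⟫ = ⟪v, g⟫ + ⟪T v, f⟫` for all `v ∈ D(T)`. -/
def SolvesNormal (T : H →ₗ.[ℂ] H) (lam : ℝ) (g f : H) (x : T.domain) : Prop :=
  ∀ v : T.domain, (lam : ℂ) * ⟪(v : H), (x : H)⟫ + ⟪T v, T x⟫ = ⟪(v : H), g⟫ + ⟪T v, f⟫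

/-- In the ℓ² sum H ⊕ H the rescaled graph {(√λ v, T v)} is closed. The orthogonal projection of
(g/√λ, f) onto it is (√λ x, T x), and orthogonality of the residual to the rescaled graph is the
normal equation for x. -/
lemma exists_solvesNormal [CompleteSpace H] {T : H →ₗ.[ℂ] H} (hT : T.IsClosed) {lam : ℝ}
    (hlam : 0 < lam) (g f : H) : ∃ x, SolvesNormal T lam g f x := by
  set c : ℂ := ((√lam : ℝ) : ℂ) with hc
  have hc0 : c ≠ 0 := by simp [hc, (Real.sqrt_pos.2 hlam).ne']
  have hcc : c * c = lam := by rw [hc, ← Complex.ofReal_mul, Real.mul_self_sqrt hlam.le]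
  have hconj : conj c = c := Complex.conj_ofReal _
  let A : WithLp 2 (H × H) →L[ℂ] H × H :=
    ((c⁻¹ • ContinuousLinearMap.fst ℂ H H).prod (ContinuousLinearMap.snd ℂ H H)).comp
      (WithLp.prodContinuousLinearEquiv 2 ℂ H H).toContinuousLinearMap
  let K : Submodule ℂ (WithLp 2 (H × H)) := T.graph.comap A.toLinearMap
  have hK : IsClosed (K : Set (WithLp 2 (H × H))) := hT.preimage A.continuous
  have : CompleteSpace K := hK.completeSpace_coe
  let z : WithLp 2 (H × H) := WithLp.toLp 2 (c⁻¹ • g, f)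
  have h1 : K.starProjection z ∈ K := K.starProjection_apply_mem z
  obtain ⟨hx, hx'⟩ := graph_mem_iff.1 (show (c⁻¹ • (K.starProjection z).ofLp.1,
    (K.starProjection z).ofLp.2) ∈ T.graph from h1)
  refine ⟨⟨_, hx⟩, fun v => ?_⟩
  have hv : (WithLp.toLp 2 (c • (v : H), T v) : WithLp 2 (H × H)) ∈ K := by
    change (c⁻¹ • (c • (v : H)), T v) ∈ T.graph
    rw [smul_smul, inv_mul_cancel₀ hc0, one_smul]
    exact T.mem_graph v
  have h2 := K.sub_starProjection_mem_orthogonal z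
  have h3 := (Submodule.mem_orthogonal _ _).1 h2 _ hv
  rw [WithLp.prod_inner_apply] at h3
  have hz1 : z.ofLp.1 = c⁻¹ • g := rfl
  have hz2 : z.ofLp.2 = f := rfl
  simp only [WithLp.ofLp_sub, Prod.fst_sub, Prod.snd_sub, hz1, hz2, inner_sub_right,
    inner_smul_left, inner_smul_right, hconj] at h3
  rw [hx', inner_smul_right, ← hcc]
  field_simp at h3 ⊢
  linear_combination -h3

/-- Subtracting the two equations and testing with x - y leaves λ‖x - y‖² + ‖T(x - y)‖² = 0. -/
lemma SolvesNormal.unique {T : H →ₗ.[ℂ] H} {lam : ℝ} (hlam : 0 < lam) {g f : H} {x y : T.domain}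
    (hx : SolvesNormal T lam g f x) (hy : SolvesNormal T lam g f y) : x = y := by
  have h1 := hx (x - y)
  have h2 := hy (x - y)
  have h3 : (lam : ℂ) * ⟪((x - y : T.domain) : H), ((x - y : T.domain) : H)⟫
      + ⟪T (x - y), T (x - y)⟫ = 0 := by
    rw [T.map_sub x y, inner_sub_right, AddSubgroupClass.coe_sub, inner_sub_right,
      ← T.map_sub, ← AddSubgroupClass.coe_sub]
    linear_combination h1 - h2
  have h4 : lam * ‖((x - y : T.domain) : H)‖ ^ 2 + ‖T (x - y)‖ ^ 2 = 0 := by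
    have := congrArg Complex.re h3
    rwa [Complex.add_re, Complex.re_ofReal_mul, ← RCLike.re_to_complex, ← RCLike.re_to_complex,
      inner_self_eq_norm_sq, inner_self_eq_norm_sq] at this
  have h5 : ‖((x - y : T.domain) : H)‖ ^ 2 = 0 := by
    have := sq_nonneg ‖T (x - y)‖
    have := sq_nonneg ‖((x - y : T.domain) : H)‖
    nlinarith
  have h6 : (x - y : T.domain) = 0 := by
    apply Subtype.ext
    simpa using h5
  exact sub_eq_zero.1 h6

section Adjoint

variable [CompleteSpace H] {T : H →ₗ.[ℂ] H} (hd : Dense (T.domain : Set H))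

include hd

/-- Exhibiting a candidate value `z` already puts `y` into D(T*), so no continuity of v ↦ ⟪T v, y⟫
has to be checked separately. -/
lemma mem_adjoint_graph_iff {y z : H} :
    (y, z) ∈ T.adjoint.graph ↔ ∀ v : T.domain, ⟪(v : H), z⟫ = ⟪T v, y⟫ := by
  rw [LinearPMap.adjoint_graph_eq_graph_adjoint hd, Submodule.mem_adjoint_iff]
  constructor
  · intro h v
    exact (sub_eq_zero.1 (h v (T v) (T.mem_graph v))).symm
  · intro h a b hab
    obtain ⟨ha, rfl⟩ := graph_mem_iff.1 hab
    exact sub_eq_zero.2 (h ⟨a, ha⟩).symm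

lemma inner_adjoint (v : T.domain) (y : T.adjoint.domain) :
    ⟪(v : H), T.adjoint y⟫ = ⟪T v, (y : H)⟫ :=
  (mem_adjoint_graph_iff hd).1 (T.adjoint.mem_graph y) v

end Adjoint

lemma natComp_mem_graph_iff {S T : H →ₗ.[ℂ] H} {x z : H} :
    (x, z) ∈ (natComp S T).graph ↔ ∃ y, (x, y) ∈ T.graph ∧ (y, z) ∈ S.graph := by
  constructor
  · intro h
    obtain ⟨hx, rfl⟩ := graph_mem_iff.1 h
    obtain ⟨⟨x', hx'⟩, hy, rfl⟩ := hx
    exact ⟨T ⟨x', hx'⟩, graph_mem_iff.2 ⟨hx', rfl⟩, graph_mem_iff.2 ⟨hy, rfl⟩⟩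
  · rintro ⟨y, h1, h2⟩
    obtain ⟨hx, rfl⟩ := graph_mem_iff.1 h1
    obtain ⟨hy, rfl⟩ := graph_mem_iff.1 h2
    exact graph_mem_iff.2 ⟨⟨⟨x, hx⟩, hy, rfl⟩, rfl⟩

lemma shift_mem_graph_iff {A : H →ₗ.[ℂ] H} {lam : ℝ} {x z : H} :
    (x, z) ∈ (shift lam A).graph ↔ (x, z - (lam : ℂ) • x) ∈ A.graph := by
  constructor
  · intro h
    obtain ⟨hx, rfl⟩ := graph_mem_iff.1 h
    refine graph_mem_iff.2 ⟨hx.2, ?_⟩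
    change A ⟨x, hx.2⟩ = ((lam : ℂ) • x + A ⟨x, hx.2⟩) - (lam : ℂ) • x
    rw [add_sub_cancel_left]
  · intro h
    obtain ⟨hx, h⟩ := graph_mem_iff.1 h
    refine graph_mem_iff.2 ⟨⟨trivial, hx⟩, ?_⟩
    change (lam : ℂ) • x + A ⟨x, hx⟩ = z
    rw [h, add_sub_cancel]

lemma bijective_of_graph {A : H →ₗ.[ℂ] H} (h : ∀ z, ∃! x, (x, z) ∈ A.graph) :
    Function.Bijective A.toFun := by
  refine ⟨fun x y hxy => ?_, fun z => ?_⟩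
  · obtain ⟨a, _, ha⟩ := h (A y)
    apply Subtype.ext
    rw [ha x (graph_mem_iff.2 ⟨x.2, hxy⟩), ha y (A.mem_graph y)]
  · obtain ⟨x, hx, _⟩ := h z
    obtain ⟨h1, h2⟩ := graph_mem_iff.1 hx
    exact ⟨⟨x, h1⟩, h2⟩

lemma mem_inverse_graph_iff {A : H →ₗ.[ℂ] H} (h : Function.Bijective A.toFun) {x z : H} :
    (z, x) ∈ A.inverse.graph ↔ (x, z) ∈ A.graph := by
  rw [LinearPMap.inverse_graph (LinearMap.ker_eq_bot.2 h.1)]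
  simp

section Normal

variable [CompleteSpace H] {T : H →ₗ.[ℂ] H} (hd : Dense (T.domain : Set H))
  {lam : ℝ}
include hd

lemma adjoint_comp_graph_iff {x g : H} :
    (x, g) ∈ (shift lam (natComp T.adjoint T)).graph ↔
      ∃ hx : x ∈ T.domain, SolvesNormal T lam g 0 ⟨x, hx⟩ := by
  rw [shift_mem_graph_iff, natComp_mem_graph_iff]
  constructor
  · rintro ⟨y, h1, h2⟩
    obtain ⟨hx, rfl⟩ := graph_mem_iff.1 h1
    refine ⟨hx, fun v => ?_⟩
    have := (mem_adjoint_graph_iff hd).1 h2 v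
    rw [inner_sub_right, inner_smul_right] at this
    rw [inner_zero_right]
    linear_combination -this
  · rintro ⟨hx, h⟩
    refine ⟨_, T.mem_graph ⟨x, hx⟩, (mem_adjoint_graph_iff hd).2 fun v => ?_⟩
    have := h v
    rw [inner_sub_right, inner_smul_right]
    rw [inner_zero_right] at this
    linear_combination -this

/-- `q` solves `(λ + T T*) q = f` iff `x = T* q` solves the regularised normal equation and
`λ q = f - T x`. -/
lemma comp_adjoint_graph_iff (hlam : 0 < lam) {q f : H} :
    (q, f) ∈ (shift lam (natComp T T.adjoint)).graph ↔
      ∃ x : T.domain, SolvesNormal T lam 0 f x ∧ q = (lam : ℂ)⁻¹ • (f - T x) ∧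
        (q, (x : H)) ∈ T.adjoint.graph := by
  have hl : (lam : ℂ) ≠ 0 := by exact_mod_cast hlam.ne'
  rw [shift_mem_graph_iff, natComp_mem_graph_iff]
  constructor
  · rintro ⟨x, h1, h2⟩
    obtain ⟨hx, hTx⟩ := graph_mem_iff.1 h2
    refine ⟨⟨x, hx⟩, fun v => ?_, ?_, h1⟩
    · have := (mem_adjoint_graph_iff hd).1 h1 v
      rw [hTx, inner_sub_right, inner_smul_right, inner_zero_right, this]
      ring
    · rw [hTx, sub_sub_cancel, smul_smul, inv_mul_cancel₀ hl, one_smul]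
  · rintro ⟨x, _, rfl, h3⟩
    refine ⟨x, h3, graph_mem_iff.2 ⟨x.2, ?_⟩⟩
    rw [smul_smul, mul_inv_cancel₀ hl, one_smul, sub_sub_cancel]

/-- With g = 0 the normal equation reads ⟪v, λx⟫ = ⟪Tv, f - Tx⟫, which is the defining relation of
T*(f - Tx) = λx. -/
lemma SolvesNormal.adjoint_graph (hlam : 0 < lam) {f : H} {x : T.domain}
    (hx : SolvesNormal T lam 0 f x) :
    ((lam : ℂ)⁻¹ • (f - T x), (x : H)) ∈ T.adjoint.graph := by
  have hl : (lam : ℂ) ≠ 0 := by exact_mod_cast hlam.ne'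
  refine (mem_adjoint_graph_iff hd).2 fun v => ?_
  have := hx v
  rw [inner_zero_right] at this
  rw [inner_smul_right, inner_sub_right]
  field_simp
  linear_combination this

lemma bijective_shift_adjoint_comp (hT : T.IsClosed) (hlam : 0 < lam) :
    Function.Bijective (shift lam (natComp T.adjoint T)).toFun := by
  refine bijective_of_graph fun g => ?_
  obtain ⟨x, hx⟩ := exists_solvesNormal hT hlam g 0
  refine ⟨x, (adjoint_comp_graph_iff hd).2 ⟨x.2, hx⟩, fun y hy => ?_⟩
  obtain ⟨hy, hy'⟩ := (adjoint_comp_graph_iff hd).1 hy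
  exact congrArg Subtype.val (hy'.unique hlam hx)

lemma bijective_shift_comp_adjoint (hT : T.IsClosed) (hlam : 0 < lam) :
    Function.Bijective (shift lam (natComp T T.adjoint)).toFun := by
  refine bijective_of_graph fun f => ?_
  obtain ⟨x, hx⟩ := exists_solvesNormal hT hlam 0 f
  refine ⟨_, (comp_adjoint_graph_iff hd hlam).2 ⟨x, hx, rfl, hx.adjoint_graph hd hlam⟩,
    fun y hy => ?_⟩
  obtain ⟨x', hx', rfl, _⟩ := (comp_adjoint_graph_iff hd hlam).1 hy
  rw [hx'.unique hlam hx]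

/-- For f in D(T*) one has ⟪Tv, f⟫ = ⟪v, T*f⟫, so the data (0, f) and (T*f, 0) give the same normal
equation. -/
lemma SolvesNormal.mem_inverse_graph (hT : T.IsClosed) (hlam : 0 < lam) {f : H} {x : T.domain}
    (hx : SolvesNormal T lam 0 f x) (hf : f ∈ T.adjoint.domain) :
    (T.adjoint ⟨f, hf⟩, (x : H)) ∈ (shift lam (natComp T.adjoint T)).inverse.graph := by
  rw [mem_inverse_graph_iff (bijective_shift_adjoint_comp hd hT hlam), adjoint_comp_graph_iff hd]
  refine ⟨x.2, fun v => ?_⟩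
  rw [inner_adjoint hd, inner_zero_right, hx v, inner_zero_right]
  ring

lemma SolvesNormal.mem_adjoint_inverse_graph (hT : T.IsClosed) (hlam : 0 < lam) {f : H}
    {x : T.domain} (hx : SolvesNormal T lam 0 f x) :
    (f, (x : H)) ∈ (natComp T.adjoint (shift lam (natComp T T.adjoint)).inverse).graph := by
  rw [natComp_mem_graph_iff]
  have h := hx.adjoint_graph hd hlam
  exact ⟨_, (mem_inverse_graph_iff (bijective_shift_comp_adjoint hd hT hlam)).2
    ((comp_adjoint_graph_iff hd hlam).2 ⟨x, hx, rfl, h⟩), h⟩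

end Normal

/-- Expansion of the functional around x: the cross terms are twice the real part of the normal
equation tested with v - x. -/
lemma SolvesNormal.tikhonov_eq {T : H →ₗ.[ℂ] H} {lam : ℝ} {f : H} {x : T.domain}
    (hx : SolvesNormal T lam 0 f x) (v : T.domain) :
    tikhonov T f lam v = tikhonov T f lam x + ‖T (v - x)‖ ^ 2
      + lam * ‖((v - x : T.domain) : H)‖ ^ 2 := by
  have h1 := congrArg Complex.re (hx (v - x))
  have h2 := norm_add_sq (𝕜 := ℂ) (T (v - x)) (T x - f)
  have h3 := norm_add_sq (𝕜 := ℂ) ((v - x : T.domain) : H) x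
  have e2 : T (v - x) + (T x - f) = T v - f := by rw [T.map_sub]; abel
  have e3 : ((v - x : T.domain) : H) + x = v := by simp
  rw [e2, inner_sub_right] at h2
  rw [e3] at h3
  rw [inner_zero_right, Complex.add_re, Complex.re_ofReal_mul, zero_add] at h1
  simp only [tikhonov, RCLike.re_to_complex, Complex.sub_re] at *
  rw [h2, h3]
  linear_combination 2 * h1

lemma SolvesNormal.isUniqueMinimizer {T : H →ₗ.[ℂ] H} {lam : ℝ} (hlam : 0 < lam) {f : H}
    {x : T.domain} (hx : SolvesNormal T lam 0 f x) : IsUniqueMinimizer T f lam x := by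
  refine ⟨x.2, fun v => ?_, fun v hv => ?_⟩
  · rw [hx.tikhonov_eq v]
    have := mul_nonneg hlam.le (sq_nonneg ‖((v - x : T.domain) : H)‖)
    have := sq_nonneg ‖T (v - x)‖
    linarith
  · have h1 := hv x
    rw [hx.tikhonov_eq v] at h1
    have h2 := sq_nonneg ‖T (v - x)‖
    have h3 : ‖((v - x : T.domain) : H)‖ ^ 2 = 0 := by
      have := sq_nonneg ‖((v - x : T.domain) : H)‖
      nlinarith
    have h4 : ((v - x : T.domain) : H) = 0 := by simpa using h3
    exact sub_eq_zero.1 h4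

end Abstract

/-! ### The Moore-Penrose inverse, minimal-norm solutions and the limit λ → 0. -/

section MoorePenrose

variable {H : Type*} [NormedAddCommGroup H] [InnerProductSpace ℂ H] {T : H →ₗ.[ℂ] H}

local notation "⟪" x "," y "⟫" => inner ℂ x y

lemma mem_nul_iff {x : H} : x ∈ nul T ↔ (x, 0) ∈ T.graph := by
  rw [graph_mem_iff]
  constructor
  · rintro ⟨y, hy, rfl⟩
    exact ⟨y.2, hy⟩
  · rintro ⟨hx, h⟩
    exact ⟨⟨x, hx⟩, h, rfl⟩

lemma mem_ran_iff {y : H} : y ∈ ran T ↔ ∃ x, (x, y) ∈ T.graph := by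
  constructor
  · rintro ⟨x, rfl⟩
    exact ⟨x, T.mem_graph x⟩
  · rintro ⟨x, h⟩
    obtain ⟨hx, rfl⟩ := graph_mem_iff.1 h
    exact ⟨⟨x, hx⟩, rfl⟩

lemma isClosed_nul (hT : T.IsClosed) : IsClosed (nul T : Set H) := by
  have : (nul T : Set H) = (fun x => (x, (0 : H))) ⁻¹' (T.graph : Set (H × H)) := by
    ext x; exact mem_nul_iff
  rw [this]
  exact hT.preimage (by fun_prop)

variable [CompleteSpace H]

lemma sub_starProjection_nul_orthogonal_mem (hT : T.IsClosed) (x : H) :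
    x - (nul T)ᗮ.starProjection x ∈ nul T := by
  have := (isClosed_nul hT).completeSpace_coe
  have h := (nul T)ᗮ.sub_starProjection_mem_orthogonal x
  rwa [Submodule.orthogonal_orthogonal] at h

/-- N(T) is closed, so the component removed by the projection lies in N(T) itself and does not
change the value of T. -/
lemma starProjection_mem_graph (hT : T.IsClosed) {x y : H} (h : (x, y) ∈ T.graph) :
    ((nul T)ᗮ.starProjection x, y) ∈ T.graph := by
  have := T.graph.sub_mem h (mem_nul_iff.1 (sub_starProjection_nul_orthogonal_mem hT x))
  simpa using this

lemma sub_starProjection_ran_mem (y : H) :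
    y - (ran T).topologicalClosure.starProjection y ∈ (ran T)ᗮ := by
  have := (ran T).topologicalClosure.sub_starProjection_mem_orthogonal y
  rwa [Submodule.orthogonal_closure] at this

lemma starProjection_ran_of_mem_orthogonal {y : H} (hy : y ∈ (ran T)ᗮ) :
    (ran T).topologicalClosure.starProjection y = 0 := by
  rw [← Submodule.orthogonal_closure] at hy
  exact (Submodule.starProjection_apply_eq_zero_iff _).2 hy

lemma starProjection_ran_of_mem {y : H} (hy : y ∈ ran T) :
    (ran T).topologicalClosure.starProjection y = y :=
  Submodule.starProjection_eq_self_iff.2 ((ran T).le_topologicalClosure hy)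

/-- The graph of the Moore-Penrose inverse: pairs `(y, x)` with `x ∈ D(T) ∩ N(T)^⊥` and
`T x` the projection of `y` onto the closure of the range. -/
def moorePenroseGraph (T : H →ₗ.[ℂ] H) : Submodule ℂ (H × H) :=
  T.graph.comap ((LinearMap.snd ℂ H H).prod
    ((ran T).topologicalClosure.starProjection.toLinearMap ∘ₗ LinearMap.fst ℂ H H)) ⊓
  (nul T)ᗮ.comap (LinearMap.snd ℂ H H)

lemma mem_moorePenroseGraph {y x : H} : (y, x) ∈ moorePenroseGraph T ↔
    (x, (ran T).topologicalClosure.starProjection y) ∈ T.graph ∧ x ∈ (nul T)ᗮ := Iff.rfl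

lemma isClosed_moorePenroseGraph (hT : T.IsClosed) :
    IsClosed (moorePenroseGraph T : Set (H × H)) := by
  have : (moorePenroseGraph T : Set (H × H)) =
      (fun p : H × H => (p.2, (ran T).topologicalClosure.starProjection p.1)) ⁻¹'
        (T.graph : Set (H × H)) ∩ Prod.snd ⁻¹' ((nul T)ᗮ : Set H) := rfl
  rw [this]
  exact (hT.preimage (by fun_prop)).inter
    ((Submodule.isClosed_orthogonal _).preimage continuous_snd)

/-- The Moore-Penrose inverse of a closed operator. -/
def moorePenrose (T : H →ₗ.[ℂ] H) : H →ₗ.[ℂ] H := (moorePenroseGraph T).toLinearPMap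

/-- The relation is single-valued: a pair (0, x) in it has x in both N(T) and N(T)^⊥. -/
lemma graph_moorePenrose : (moorePenrose T).graph = moorePenroseGraph T := by
  refine Submodule.toLinearPMap_graph_eq _ ?_
  rintro ⟨y, x⟩ h rfl
  obtain ⟨h1, h2⟩ := mem_moorePenroseGraph.1 h
  rw [map_zero] at h1
  have h3 := (Submodule.mem_orthogonal _ _).1 h2 _ (mem_nul_iff.2 h1)
  exact inner_self_eq_zero.1 h3

lemma mem_graph_moorePenrose {y x : H} : (y, x) ∈ (moorePenrose T).graph ↔
    (x, (ran T).topologicalClosure.starProjection y) ∈ T.graph ∧ x ∈ (nul T)ᗮ := by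
  rw [graph_moorePenrose, mem_moorePenroseGraph]

lemma dense_ran_sup_orthogonal (T : H →ₗ.[ℂ] H) :
    Dense ((ran T ⊔ (ran T)ᗮ : Submodule ℂ H) : Set H) := by
  rw [Submodule.dense_iff_topologicalClosure_eq_top, Submodule.topologicalClosure_eq_top_iff,
    ← Submodule.inf_orthogonal]
  exact (Submodule.orthogonal_disjoint _).eq_bot

lemma isMoorePenrose_moorePenrose (hT : T.IsClosed) : IsMoorePenrose T (moorePenrose T) := by
  have hdom : (moorePenrose T).domain = ran T ⊔ (ran T)ᗮ := by
    apply le_antisymm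
    · intro y hy
      obtain ⟨x, hx⟩ := LinearPMap.mem_domain_iff.1 hy
      have h := (mem_graph_moorePenrose.1 hx).1
      rw [← add_sub_cancel ((ran T).topologicalClosure.starProjection y) y]
      exact Submodule.add_mem_sup (mem_ran_iff.2 ⟨x, h⟩) (sub_starProjection_ran_mem y)
    · intro y hy
      obtain ⟨y1, h1, y2, h2, rfl⟩ := Submodule.mem_sup.1 hy
      obtain ⟨x, hx⟩ := mem_ran_iff.1 h1
      refine LinearPMap.mem_domain_iff.2 ⟨_, mem_graph_moorePenrose.2
        ⟨?_, (nul T)ᗮ.starProjection_apply_mem x⟩⟩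
      rw [map_add, starProjection_ran_of_mem h1, starProjection_ran_of_mem_orthogonal h2, add_zero]
      exact starProjection_mem_graph hT hx
  refine ⟨?_, ?_, hdom, fun y => ?_, fun x => ?_, ?_⟩
  · rw [LinearPMap.IsClosed, graph_moorePenrose]
    exact isClosed_moorePenroseGraph hT
  · rw [hdom]
    exact dense_ran_sup_orthogonal T
  · exact graph_mem_iff.1 (mem_graph_moorePenrose.1 ((moorePenrose T).mem_graph y)).1
  · refine graph_mem_iff.1 (mem_graph_moorePenrose.2 ⟨?_, (nul T)ᗮ.starProjection_apply_mem _⟩)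
    rw [starProjection_ran_of_mem (y := T x) (mem_ran_iff.2 ⟨(x : H), T.mem_graph x⟩)]
    exact starProjection_mem_graph hT (T.mem_graph x)
  · ext y
    rw [mem_nul_iff, mem_graph_moorePenrose]
    constructor
    · rintro ⟨h, -⟩
      have h1 := T.graph_fst_eq_zero_snd h rfl
      have h2 := sub_starProjection_ran_mem (T := T) y
      rwa [h1, sub_zero] at h2
    · intro h
      rw [starProjection_ran_of_mem_orthogonal h]
      exact ⟨T.graph.zero_mem, Submodule.zero_mem _⟩

/-- The domain is prescribed, and on T x + y₂ with y₂ ⊥ R(T) the conditions `left` and `nul_eq`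
force the value to be the projection of x onto N(T)^⊥. -/
lemma IsMoorePenrose.unique {S S' : H →ₗ.[ℂ] H} (h : IsMoorePenrose T S)
    (h' : IsMoorePenrose T S') : S = S' := by
  refine LinearPMap.ext (h.domain_eq.trans h'.domain_eq.symm) ?_
  intro y hy hy'
  have hy0 := hy
  rw [h.domain_eq] at hy0
  obtain ⟨y1, ⟨x, rfl⟩, y2, h2, rfl⟩ := Submodule.mem_sup.1 hy0
  have key : ∀ {S : H →ₗ.[ℂ] H}, IsMoorePenrose T S →
      (T x + y2, (nul T)ᗮ.starProjection (x : H)) ∈ S.graph := fun {S} h => by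
    have e1 := graph_mem_iff.2 (h.left x)
    have e2 := h2
    rw [← h.nul_eq, mem_nul_iff] at e2
    simpa using S.graph.add_mem e1 e2
  obtain ⟨_, k1⟩ := graph_mem_iff.1 (key h)
  obtain ⟨_, k2⟩ := graph_mem_iff.1 (key h')
  exact k1.trans k2.symm

lemma existsUnique_isMoorePenrose (hT : T.IsClosed) : ∃! S, IsMoorePenrose T S :=
  ⟨_, isMoorePenrose_moorePenrose hT, fun _ h => h.unique (isMoorePenrose_moorePenrose hT)⟩

/-- Any other solution differs from this one by a null vector orthogonal to it, so Pythagoras gives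
both minimality and uniqueness. -/
lemma isMinimalNormSolution_starProjection (hT : T.IsClosed) (x : T.domain) :
    IsMinimalNormSolution T (T x) ((nul T)ᗮ.starProjection (x : H)) := by
  have h0 := starProjection_mem_graph hT (T.mem_graph x)
  set y := (nul T)ᗮ.starProjection (x : H) with hy
  refine ⟨graph_mem_iff.1 h0, fun v hv => ?_⟩
  have h1 : (v : H) - y ∈ nul T := by
    rw [mem_nul_iff]
    have := T.graph.sub_mem (T.mem_graph v) h0
    simpa [hv] using this
  have h2 : ⟪(v : H) - y, y⟫ = 0 := (Submodule.mem_orthogonal _ _).1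
    ((nul T)ᗮ.starProjection_apply_mem _) _ h1
  have h3 := norm_add_sq_eq_norm_sq_add_norm_sq_of_inner_eq_zero _ _ h2
  rw [sub_add_cancel] at h3
  have h4 := norm_nonneg ((v : H) - y)
  refine ⟨?_, fun e => ?_⟩
  · exact le_of_sq_le_sq (by nlinarith) (norm_nonneg _)
  · rw [e] at h3
    have : ‖(v : H) - y‖ = 0 := by nlinarith
    exact sub_eq_zero.1 (norm_eq_zero.1 this)

/-- A vector orthogonal to the range of `T*` is in the null space of `T`. -/
lemma mem_nul_of_orthogonal_ran_adjoint (hd : Dense (T.domain : Set H)) (hT : T.IsClosed) {z : H}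
    (hz : ∀ q : T.adjoint.domain, ⟪T.adjoint q, z⟫ = 0) : z ∈ nul T := by
  -- Solve (I + T*T)x = z. Then z - x = T*(Tx) is orthogonal to z by hypothesis, while ⟪z - x, x⟫ =
  -- ‖Tx‖². Hence ‖z - x‖² = -‖Tx‖², and both sides vanish.
  obtain ⟨x, hx⟩ := exists_solvesNormal hT one_pos z 0
  have h1 := (adjoint_comp_graph_iff hd).2 ⟨x.2, hx⟩
  rw [shift_mem_graph_iff, natComp_mem_graph_iff] at h1
  obtain ⟨q, hq1, hq2⟩ := h1
  obtain ⟨_, rfl⟩ := graph_mem_iff.1 hq1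
  obtain ⟨hq, e⟩ := graph_mem_iff.1 hq2
  have h2 := hz ⟨_, hq⟩
  have h3 := inner_adjoint hd x ⟨_, hq⟩
  simp only [Complex.ofReal_one, one_smul] at e
  rw [e] at h2 h3
  have h4 : ⟪z - x, z - x⟫ + ⟪T x, T x⟫ = 0 := by
    have h5 : ⟪z - x, (x : H)⟫ = ⟪T x, T x⟫ := by
      rw [← inner_conj_symm, h3, inner_conj_symm]
    rw [inner_sub_right, h2, h5]; ring
  have h6 : ‖z - x‖ ^ 2 + ‖T x‖ ^ 2 = 0 := by
    have := congrArg Complex.re h4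
    rwa [Complex.add_re, ← RCLike.re_to_complex, ← RCLike.re_to_complex,
      inner_self_eq_norm_sq, inner_self_eq_norm_sq] at this
  have h7 : ‖z - x‖ = 0 := by nlinarith [norm_nonneg (z - x), sq_nonneg ‖T x‖]
  have h8 : ‖T x‖ = 0 := by nlinarith [norm_nonneg (T x), sq_nonneg ‖z - x‖]
  rw [sub_eq_zero.1 (norm_eq_zero.1 h7), mem_nul_iff]
  exact graph_mem_iff.2 ⟨x.2, norm_eq_zero.1 h8⟩

lemma nul_orthogonal_le (hd : Dense (T.domain : Set H)) (hT : T.IsClosed) :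
    (nul T)ᗮ ≤ (ran T.adjoint).topologicalClosure := by
  rw [← Submodule.orthogonal_orthogonal_eq_closure]
  refine Submodule.orthogonal_le fun z hz => mem_nul_of_orthogonal_ran_adjoint hd hT fun q => ?_
  exact (Submodule.mem_orthogonal _ _).1 hz _ ⟨q, rfl⟩

/-- The normal equation tested with y - x_λ bounds x_λ by y, makes T(y - x_λ) of order √λ, and gives
‖x_λ - y‖² ≤ Re⟪y, y - x_λ⟫. If y were T*q, the right side would be Re⟪q, T(y - x_λ)⟫ → 0. In
general y is only a limit of such vectors, and boundedness of x_λ absorbs the error. -/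
lemma tendsto_regularised (hd : Dense (T.domain : Set H)) (hT : T.IsClosed) {y : T.domain}
    (hy : (y : H) ∈ (nul T)ᗮ) {x : ℝ → T.domain}
    (hx : ∀ lam, 0 < lam → SolvesNormal T lam 0 (T y) (x lam)) :
    Tendsto (fun lam => ‖(x lam : H) - y‖) (𝓝[>] 0) (𝓝 0) := by
  have id1 : ∀ lam, 0 < lam →
      lam * (⟪((y - x lam : T.domain) : H), (x lam : H)⟫).re = ‖T (y - x lam)‖ ^ 2 := by
    intro lam hlam
    have h1 := hx lam hlam (y - x lam)
    have h2 : (lam : ℂ) * ⟪((y - x lam : T.domain) : H), (x lam : H)⟫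
        = ⟪T (y - x lam), T (y - x lam)⟫ := by
      have h3 := congrArg (fun z => ⟪T (y - x lam), z⟫) (T.map_sub y (x lam))
      rw [inner_sub_right] at h3
      rw [inner_zero_right] at h1
      linear_combination h1 - h3
    have h3 := congrArg Complex.re h2
    rwa [Complex.re_ofReal_mul, ← RCLike.re_to_complex (x := ⟪T (y - x lam), T (y - x lam)⟫),
      inner_self_eq_norm_sq] at h3
  have id2 : ∀ lam, 0 < lam → 0 ≤ (⟪((y - x lam : T.domain) : H), (x lam : H)⟫).re := by
    intro lam hlam
    by_contra! h
    have := id1 lam hlam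
    nlinarith [sq_nonneg ‖T (y - x lam)‖]
  have id3 : ∀ lam, 0 < lam → ‖(x lam : H)‖ ≤ ‖(y : H)‖ := by
    intro lam hlam
    have h1 := id2 lam hlam
    rw [AddSubgroupClass.coe_sub, inner_sub_left, Complex.sub_re, ← RCLike.re_to_complex,
      ← RCLike.re_to_complex, inner_self_eq_norm_sq] at h1
    have h2 := re_inner_le_norm (𝕜 := ℂ) (y : H) (x lam : H)
    by_contra! h
    nlinarith [norm_nonneg (y : H)]
  have id4 : ∀ lam, 0 < lam →
      ‖(x lam : H) - y‖ ^ 2 ≤ (⟪(y : H), ((y - x lam : T.domain) : H)⟫).re := by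
    intro lam hlam
    have h1 := id2 lam hlam
    have h2 := inner_self_eq_norm_sq (𝕜 := ℂ) ((y : H) - x lam)
    rw [norm_sub_rev, ← h2]
    rw [AddSubgroupClass.coe_sub] at *
    have h3 : ⟪(y : H) - x lam, (y : H) - x lam⟫
        = conj ⟪(y : H), (y : H) - x lam⟫ - ⟪(y : H) - x lam, (x lam : H)⟫ := by
      rw [inner_conj_symm, ← inner_sub_right]
    rw [h3, RCLike.re_to_complex, Complex.sub_re, Complex.conj_re]
    linarith
  have id5 : ∀ lam, 0 < lam → ‖((y - x lam : T.domain) : H)‖ ≤ 2 * ‖(y : H)‖ := by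
    intro lam hlam
    have h1 := norm_sub_le (y : H) (x lam : H)
    have h2 := id3 lam hlam
    rw [AddSubgroupClass.coe_sub]
    linarith
  have id6 : ∀ lam, 0 < lam → ‖T (y - x lam)‖ ≤ √lam * (2 * ‖(y : H)‖) := by
    intro lam hlam
    have h1 := id1 lam hlam
    have h2 := re_inner_le_norm (𝕜 := ℂ) ((y - x lam : T.domain) : H) (x lam : H)
    rw [RCLike.re_to_complex] at h2
    have h3 := id5 lam hlam
    have h4 := id3 lam hlam
    have h5 : ‖((y - x lam : T.domain) : H)‖ * ‖(x lam : H)‖ ≤ 2 * ‖(y : H)‖ * (2 * ‖(y : H)‖) := by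
      gcongr
      linarith [norm_nonneg (y : H)]
    refine le_of_sq_le_sq ?_ (by positivity)
    rw [mul_pow, Real.sq_sqrt hlam.le, ← h1, pow_two]
    exact mul_le_mul_of_nonneg_left (h2.trans h5) hlam.le
  suffices h : Tendsto (fun lam => ‖(x lam : H) - y‖ ^ 2) (𝓝[>] 0) (𝓝 0) by
    have := (Real.continuous_sqrt.tendsto 0).comp h
    simpa [Function.comp_def, Real.sqrt_sq] using this
  rw [Metric.tendsto_nhds]
  intro ε hε
  obtain ⟨δ, hδ, hδε⟩ : ∃ δ > 0, δ * (2 * ‖(y : H)‖) < ε / 2 := by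
    refine ⟨ε / (4 * (2 * ‖(y : H)‖ + 1)), by positivity, ?_⟩
    rw [div_mul_eq_mul_div, div_lt_iff₀ (by positivity)]
    nlinarith [norm_nonneg (y : H)]
  -- q is fixed before λ: the part with y - T*q stays below ε/2 by the choice of δ, and the part
  -- with q tends to 0 at the rate √λ.
  obtain ⟨_, ⟨q, rfl⟩, hq⟩ := Metric.mem_closure_iff.1 (nul_orthogonal_le hd hT hy) δ hδ
  have hlim : Tendsto (fun lam : ℝ => ‖(q : H)‖ * (√lam * (2 * ‖(y : H)‖))) (𝓝[>] 0) (𝓝 0) := by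
    have : Tendsto (fun lam : ℝ => ‖(q : H)‖ * (√lam * (2 * ‖(y : H)‖))) (𝓝 0)
        (𝓝 (‖(q : H)‖ * (√0 * (2 * ‖(y : H)‖)))) :=
      Continuous.tendsto (by fun_prop) 0
    simpa using this.mono_left nhdsWithin_le_nhds
  filter_upwards [self_mem_nhdsWithin, hlim.eventually_lt_const (half_pos hε)] with lam hlam h
  have hlam : 0 < lam := hlam
  rw [Real.dist_eq, sub_zero, abs_of_nonneg (sq_nonneg _)]
  refine (id4 lam hlam).trans_lt ?_
  have e1 : ⟪(y : H), ((y - x lam : T.domain) : H)⟫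
      = ⟪(y : H) - T.adjoint q, ((y - x lam : T.domain) : H)⟫ + ⟪(q : H), T (y - x lam)⟫ := by
    rw [inner_sub_left, ← inner_conj_symm (q : H), ← inner_adjoint hd, inner_conj_symm]
    ring
  rw [e1, Complex.add_re]
  have b1 := re_inner_le_norm (𝕜 := ℂ) ((y : H) - T.adjoint q) ((y - x lam : T.domain) : H)
  have b2 := re_inner_le_norm (𝕜 := ℂ) (q : H) (T (y - x lam))
  rw [RCLike.re_to_complex] at b1 b2
  have b3 : ‖(y : H) - T.adjoint q‖ * ‖((y - x lam : T.domain) : H)‖ ≤ δ * (2 * ‖(y : H)‖) := by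
    have hq' : ‖(y : H) - T.adjoint q‖ < δ := by rw [← dist_eq_norm]; exact hq
    exact mul_le_mul hq'.le (id5 lam hlam) (norm_nonneg _) hδ.le
  have b4 := mul_le_mul_of_nonneg_left (id6 lam hlam) (norm_nonneg (q : H))
  linarith

end MoorePenrose

/-! ### Pull-out, Cauchy-Schwarz and integral identities for the conditional expectation. -/

section CondExpTools

variable {X : Type*} {m m0 : MeasurableSpace X} {μ : Measure[m0] X}

/-- The measures with densities E(g) and g agree on the sub-σ-algebra, and φ only sees their
restrictions to it. -/
lemma lintegral_mul_condLExp (hm : m ≤ m0) [SigmaFinite (μ.trim hm)] {φ g : X → ℝ≥0∞}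
    (hφ : Measurable[m] φ) (hg : AEMeasurable[m0] g μ) :
    ∫⁻ x, φ x * condLExp m μ g x ∂μ = ∫⁻ x, φ x * g x ∂μ := by
  have key : (μ.withDensity (condLExp m μ g)).trim hm = (μ.withDensity g).trim hm := by
    refine @Measure.ext _ m _ _ fun s hs => ?_
    rw [trim_measurableSet_eq hm hs, trim_measurableSet_eq hm hs, withDensity_apply _ (hm s hs),
      withDensity_apply _ (hm s hs), setLIntegral_condLExp hm μ g hs]
  have h : ∀ g : X → ℝ≥0∞, AEMeasurable[m0] g μ →
      ∫⁻ x, φ x * g x ∂μ = ∫⁻ x, φ x ∂((μ.withDensity g).trim hm) := fun g hg => by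
    rw [lintegral_trim hm hφ, lintegral_withDensity_eq_lintegral_mul₀ hg
      (hφ.mono hm le_rfl).aemeasurable]
    simp only [Pi.mul_apply, mul_comm]
  rw [h g hg, h _ (measurable_condLExp' m μ g).aemeasurable, key]

lemma condLExp_mul (hm : m ≤ m0) [SigmaFinite (μ.trim hm)] {φ g : X → ℝ≥0∞}
    (hφ : Measurable[m] φ) (hg : AEMeasurable[m0] g μ) :
    condLExp m μ (fun x => φ x * g x) =ᵐ[μ] fun x => φ x * condLExp m μ g x := by
  refine (ae_eq_condLExp hm μ _ (hφ.mul (measurable_condLExp m μ g)) fun s hs => ?_).symm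
  have e : ∀ g : X → ℝ≥0∞, ∫⁻ x in s, φ x * g x ∂μ = ∫⁻ x, s.indicator φ x * g x ∂μ := fun g => by
    rw [← lintegral_indicator (hm s hs)]
    refine lintegral_congr fun x => ?_
    by_cases hx : x ∈ s <;> simp [hx]
  change ∫⁻ x in s, φ x * condLExp m μ g x ∂μ = _
  rw [e, e, lintegral_mul_condLExp hm (hφ.indicator hs) hg]

lemma condLExp_iSup (hm : m ≤ m0) [SigmaFinite (μ.trim hm)] {g : ℕ → X → ℝ≥0∞}
    (hg : ∀ n, AEMeasurable[m0] (g n) μ) (hmono : Monotone g) :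
    condLExp m μ (fun x => ⨆ n, g n x) =ᵐ[μ] fun x => ⨆ n, condLExp m μ (g n) x := by
  refine (ae_eq_condLExp hm μ _
    (Measurable.iSup fun n => measurable_condLExp m μ (g n)) fun s hs => ?_).symm
  rw [lintegral_iSup_ae (fun n => measurable_condLExp' m μ (g n)) fun n =>
      ae_restrict_of_ae (condLExp_mono (ae_of_all _ (hmono n.le_succ))),
    lintegral_iSup' (fun n => (hg n).restrict) (ae_of_all _ fun x i j h => hmono h x)]
  exact iSup_congr fun n => setLIntegral_condLExp hm μ (g n) hs

/-- The quadratic A c² - 2 Z c + B is nonnegative for all real c, so its discriminant is at most 0.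
Rational c suffice by density, which keeps the exceptional sets countable in the almost-everywhere
application. -/
lemma sq_le_mul_of_forall_rat {A B Z : ℝ}
    (h : ∀ c : ℚ, 0 < c → 2 * Z ≤ c * A + (c : ℝ)⁻¹ * B) (hA : 0 ≤ A) (hB : 0 ≤ B) (hZ : 0 ≤ Z) :
    Z ^ 2 ≤ A * B := by
  have h1 : ∀ c : ℝ, 0 ≤ A * (c * c) + (-2 * Z) * c + B := by
    intro c
    refine Rat.denseRange_cast.induction_on (p := fun c : ℝ => 0 ≤ A * (c * c) + (-2 * Z) * c + B)
      c (isClosed_le continuous_const (by fun_prop)) fun r => ?_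
    rcases le_or_gt r 0 with hr | hr
    · have hr : (r : ℝ) ≤ 0 := by exact_mod_cast hr
      have := mul_nonneg hZ (neg_nonneg.2 hr)
      have := mul_nonneg hA (mul_self_nonneg (r : ℝ))
      linarith
    · have h2 := h r hr
      have hr : (0 : ℝ) < r := by exact_mod_cast hr
      have h3 := mul_le_mul_of_nonneg_left h2 hr.le
      rw [mul_add, ← mul_assoc (r : ℝ) (r : ℝ)⁻¹, mul_inv_cancel₀ hr.ne'] at h3
      linarith
  have h2 := discrim_le_zero h1
  rw [discrim] at h2
  linarith

/-- Conditional Cauchy-Schwarz: apply E to 2|pq| ≤ c|p|² + c⁻¹|q|² for every positive rational c and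
optimise pointwise. -/
lemma condLExp_mul_sq_le (hm : m ≤ m0) [SigmaFinite (μ.trim hm)] {p q : X → ℂ}
    (hp : AEMeasurable[m0] p μ) (hq : AEMeasurable[m0] q μ) :
    ∀ᵐ x ∂μ, condSq m μ p x < ∞ → condSq m μ q x < ∞ →
      condLExp m μ (fun y => ‖p y * q y‖ₑ) x ^ 2 ≤ condSq m μ p x * condSq m μ q x := by
  have key : ∀ c : ℚ, 0 < c → ∀ᵐ x ∂μ, 2 * condLExp m μ (fun y => ‖p y * q y‖ₑ) x ≤
      ENNReal.ofReal c * condSq m μ p x + ENNReal.ofReal (c : ℝ)⁻¹ * condSq m μ q x := by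
    intro c hc
    have hc : (0 : ℝ) < c := by exact_mod_cast hc
    have e1 := condLExp_mul hm (μ := μ) (φ := fun _ => 2) measurable_const (hp.mul hq).enorm
    have e2 := condLExp_mul hm (μ := μ) (φ := fun _ => ENNReal.ofReal c) measurable_const
      (hp.enorm.pow_const 2)
    have e3 := condLExp_mul hm (μ := μ) (φ := fun _ => ENNReal.ofReal (c : ℝ)⁻¹) measurable_const
      (hq.enorm.pow_const 2)
    have e4 := condLExp_add_left (mΩ := m) (P := μ)
      (X := fun x => ENNReal.ofReal c * ‖p x‖ₑ ^ 2)
      (fun x => ENNReal.ofReal (c : ℝ)⁻¹ * ‖q x‖ₑ ^ 2)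
      ((hp.enorm.pow_const 2).const_mul _)
    have e5 := condLExp_mono (mΩ := m) (P := μ) (X := fun x => 2 * ‖p x * q x‖ₑ)
      (Y := (fun x => ENNReal.ofReal c * ‖p x‖ₑ ^ 2) +
        fun x => ENNReal.ofReal (c : ℝ)⁻¹ * ‖q x‖ₑ ^ 2) (ae_of_all _ fun x => by
        simp only [Pi.add_apply]
        rw [← ofReal_norm, ← ofReal_norm, ← ofReal_norm, norm_mul,
          ← ENNReal.ofReal_pow (norm_nonneg _), ← ENNReal.ofReal_pow (norm_nonneg _),
          ← ENNReal.ofReal_mul hc.le, ← ENNReal.ofReal_mul (inv_nonneg.2 hc.le),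
          ← ENNReal.ofReal_add (by positivity) (by positivity), ← ENNReal.ofReal_ofNat,
          ← ENNReal.ofReal_mul (by norm_num)]
        refine ENNReal.ofReal_le_ofReal ?_
        have h1 : (c : ℝ) * ‖p x‖ ^ 2 + (c : ℝ)⁻¹ * ‖q x‖ ^ 2 - 2 * (‖p x‖ * ‖q x‖)
            = (c : ℝ)⁻¹ * (c * ‖p x‖ - ‖q x‖) ^ 2 := by
          field_simp; ring
        have h2 : 0 ≤ (c : ℝ)⁻¹ * (c * ‖p x‖ - ‖q x‖) ^ 2 := by positivity
        linarith)
    filter_upwards [e1, e2, e3, e4, e5] with x e1 e2 e3 e4 e5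
    simp only [Pi.mul_apply] at e1
    rw [e1, e4, Pi.add_apply, e2, e3] at e5
    exact e5
  have key' : ∀ᵐ x ∂μ, ∀ c : ℚ, 0 < c → 2 * condLExp m μ (fun y => ‖p y * q y‖ₑ) x ≤
      ENNReal.ofReal c * condSq m μ p x + ENNReal.ofReal (c : ℝ)⁻¹ * condSq m μ q x := by
    refine ae_all_iff.2 fun c => ?_
    by_cases hc : 0 < c
    · filter_upwards [key c hc] with x hx _ using hx
    · exact ae_of_all _ fun x h => absurd h hc
  filter_upwards [key'] with x hx hA hB
  set Z := condLExp m μ (fun y => ‖p y * q y‖ₑ) x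
  have hZ : Z < ∞ := by
    have := (hx 1 one_pos).trans_lt
      (ENNReal.add_lt_top.2 ⟨ENNReal.mul_lt_top (by finiteness) hA,
        ENNReal.mul_lt_top (by finiteness) hB⟩)
    exact ENNReal.lt_top_of_mul_ne_top_right this.ne two_ne_zero
  rw [← ENNReal.toReal_le_toReal (by finiteness) (ENNReal.mul_lt_top hA hB).ne,
    ENNReal.toReal_pow, ENNReal.toReal_mul]
  refine sq_le_mul_of_forall_rat (fun c hc => ?_) (by positivity) (by positivity) (by positivity)
  have h1 := ENNReal.toReal_mono (ENNReal.add_lt_top.2 ⟨ENNReal.mul_lt_top (by finiteness) hA,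
    ENNReal.mul_lt_top (by finiteness) hB⟩).ne (hx c hc)
  have hc : (0 : ℝ) < c := by exact_mod_cast hc
  rwa [ENNReal.toReal_add (ENNReal.mul_lt_top (by finiteness) hA).ne
    (ENNReal.mul_lt_top (by finiteness) hB).ne, ENNReal.toReal_mul, ENNReal.toReal_mul,
    ENNReal.toReal_mul, ENNReal.toReal_ofReal hc.le, ENNReal.toReal_ofReal (inv_nonneg.2 hc.le),
    ENNReal.toReal_ofNat] at h1

lemma measurable_condERe (m : MeasurableSpace X) {m0 : MeasurableSpace X} (μ : Measure[m0] X)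
    (f : X → ℝ) : Measurable[m] (condERe m μ f) :=
  (measurable_condLExp m μ _).ennreal_toReal.sub (measurable_condLExp m μ _).ennreal_toReal

lemma measurable_condE (m : MeasurableSpace X) {m0 : MeasurableSpace X} (μ : Measure[m0] X)
    (f : X → ℂ) : Measurable[m] (condE m μ f) :=
  (Complex.measurable_ofReal.comp (measurable_condERe m μ _)).add
    ((Complex.measurable_ofReal.comp (measurable_condERe m μ _)).mul measurable_const)

lemma condERe_neg (f : X → ℝ) : condERe m μ (fun x => -f x) = fun x => -condERe m μ f x := by
  ext x; simp [condERe]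

lemma condE_conj (f : X → ℂ) :
    condE m μ (fun x => conj (f x)) = fun x => conj (condE m μ f x) := by
  ext x
  simp only [condE, Complex.conj_re, Complex.conj_im, condERe_neg]
  apply Complex.ext <;> simp

lemma Conditionable.conj {f : X → ℂ} (hf : Conditionable m μ f) :
    Conditionable m μ (fun x => conj (f x)) := by
  simpa [Conditionable, RCLike.enorm_conj] using hf

/-- At each point the positive or the negative part of φ vanishes, and `ENNReal.toReal` is
multiplicative even at ∞. So finiteness of E(|f|) is not required, and the rule applies to products
not known to be conditionable. -/
lemma condERe_mul (hm : m ≤ m0) [SigmaFinite (μ.trim hm)] {φ f : X → ℝ}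
    (hφ : Measurable[m] φ) (hf : AEMeasurable[m0] f μ) :
    condERe m μ (fun x => φ x * f x) =ᵐ[μ] fun x => φ x * condERe m μ f x := by
  have e : ∀ {f : X → ℝ}, AEMeasurable[m0] f μ →
      condLExp m μ (fun x => ENNReal.ofReal (φ x * f x)) =ᵐ[μ] fun x =>
        ENNReal.ofReal (φ x) * condLExp m μ (fun y => ENNReal.ofReal (f y)) x
        + ENNReal.ofReal (-φ x) * condLExp m μ (fun y => ENNReal.ofReal (-f y)) x := by
    intro f hf
    have e0 : (fun x => ENNReal.ofReal (φ x * f x)) =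
        (fun x => ENNReal.ofReal (φ x) * ENNReal.ofReal (f x))
        + fun x => ENNReal.ofReal (-φ x) * ENNReal.ofReal (-f x) := by
      ext x
      rcases le_total 0 (φ x) with h | h
      · simp [ENNReal.ofReal_mul h, ENNReal.ofReal_of_nonpos (neg_nonpos.2 h)]
      · rw [← neg_mul_neg, ENNReal.ofReal_mul (neg_nonneg.2 h)]
        simp [ENNReal.ofReal_of_nonpos h]
    rw [e0]
    have hφ' := (hφ.mono hm le_rfl).ennreal_ofReal
    filter_upwards [condLExp_add_left (mΩ := m) (P := μ)
      (X := fun x => ENNReal.ofReal (φ x) * ENNReal.ofReal (f x))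
      (fun x => ENNReal.ofReal (-φ x) * ENNReal.ofReal (-f x))
      (hφ'.aemeasurable.mul hf.ennreal_ofReal),
      condLExp_mul hm (μ := μ) hφ.ennreal_ofReal hf.ennreal_ofReal,
      condLExp_mul hm (μ := μ) hφ.neg.ennreal_ofReal hf.neg.ennreal_ofReal] with x h1 h2 h3
    rw [h1, Pi.add_apply]
    exact congrArg₂ _ h2 h3
  filter_upwards [e hf, e hf.neg] with x h1 h2
  simp only [Pi.neg_apply, neg_neg, mul_neg] at h2
  simp only [condERe]
  rw [h1, h2]
  rcases le_total 0 (φ x) with h | h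
  · simp [ENNReal.ofReal_of_nonpos (neg_nonpos.2 h), ENNReal.toReal_ofReal h, mul_sub]
  · simp [ENNReal.ofReal_of_nonpos h, ENNReal.toReal_ofReal (neg_nonneg.2 h), mul_sub]
    ring

lemma condE_ofReal_mul (hm : m ≤ m0) [SigmaFinite (μ.trim hm)] {φ : X → ℝ} {f : X → ℂ}
    (hφ : Measurable[m] φ) (hf : AEMeasurable[m0] f μ) :
    condE m μ (fun x => (φ x : ℂ) * f x) =ᵐ[μ] fun x => (φ x : ℂ) * condE m μ f x := by
  filter_upwards [condERe_mul hm hφ (Complex.measurable_re.comp_aemeasurable hf),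
    condERe_mul hm hφ (Complex.measurable_im.comp_aemeasurable hf)] with x h1 h2
  simp only [Function.comp_def] at h1 h2
  simp only [condE, Complex.re_ofReal_mul, Complex.im_ofReal_mul]
  rw [h1, h2]
  push_cast
  ring

lemma condLExp_enorm_mul_lt_top (hm : m ≤ m0) [SigmaFinite (μ.trim hm)] {E : Type*}
    [NormedRing E] [NormMulClass E] [MeasurableSpace E] [BorelSpace E] {φ f : X → E}
    (hφ : Measurable[m] φ) (hfm : AEMeasurable[m0] f μ)
    (hf : ∀ᵐ x ∂μ, condLExp m μ (fun y => ‖f y‖ₑ) x < ∞) :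
    ∀ᵐ x ∂μ, condLExp m μ (fun y => ‖φ y * f y‖ₑ) x < ∞ := by
  simp only [enorm_mul]
  filter_upwards [condLExp_mul hm (μ := μ) (measurable_enorm.comp hφ) hfm.enorm, hf] with x h1 h2
  simp only [Function.comp_apply] at h1
  rw [h1]
  exact ENNReal.mul_lt_top (by finiteness) h2

lemma Conditionable.mul (hm : m ≤ m0) [SigmaFinite (μ.trim hm)] {φ f : X → ℂ}
    (hφ : Measurable[m] φ) (hfm : AEMeasurable[m0] f μ) (hf : Conditionable m μ f) :
    Conditionable m μ (fun x => φ x * f x) :=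
  condLExp_enorm_mul_lt_top hm hφ hfm hf

/-- For complex φ the real and imaginary parts of the product are sums of two terms. Splitting E
over these sums is what calls for conditionability. -/
lemma condE_mul (hm : m ≤ m0) [SigmaFinite (μ.trim hm)] {φ f : X → ℂ}
    (hφ : Measurable[m] φ) (hfm : AEMeasurable[m0] f μ) (hf : Conditionable m μ f) :
    condE m μ (fun x => φ x * f x) =ᵐ[μ] fun x => φ x * condE m μ f x := by
  have mre := Complex.measurable_re.comp_aemeasurable hfm
  have mim := Complex.measurable_im.comp_aemeasurable hfm
  have pre : Measurable[m] fun x => (φ x).re := Complex.measurable_re.comp hφ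
  have pim : Measurable[m] fun x => (φ x).im := Complex.measurable_im.comp hφ
  have nre : Measurable[m] fun x => -(φ x).im := pim.neg
  have c : ∀ {ψ : X → ℝ}, Measurable[m] ψ → AEMeasurable[m0] ψ μ := fun h =>
    (h.mono hm le_rfl).aemeasurable
  have a1 := condERe_add (m := m) ((c pre).mul mre) ((c nre).mul mim)
    (condLExp_enorm_mul_lt_top hm pre mre hf.re) (condLExp_enorm_mul_lt_top hm nre mim hf.im)
  have a2 := condERe_add (m := m) ((c pre).mul mim) ((c pim).mul mre)
    (condLExp_enorm_mul_lt_top hm pre mim hf.im) (condLExp_enorm_mul_lt_top hm pim mre hf.re)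
  have b1 := condERe_mul hm pre mre
  have b2 := condERe_mul hm nre mim
  have b3 := condERe_mul hm pre mim
  have b4 := condERe_mul hm pim mre
  have e1 : (fun x => (φ x * f x).re) = fun x => (φ x).re * (f x).re + -(φ x).im * (f x).im := by
    ext x; rw [Complex.mul_re]; ring
  have e2 : (fun x => (φ x * f x).im) = fun x => (φ x).re * (f x).im + (φ x).im * (f x).re := by
    ext x; rw [Complex.mul_im]
  filter_upwards [a1, a2, b1, b2, b3, b4] with x a1 a2 b1 b2 b3 b4
  simp only [Function.comp_def, Pi.mul_def] at a1 a2 b1 b2 b3 b4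
  simp only [condE, e1, e2]
  rw [a1, a2, b1, b2, b3, b4]
  apply Complex.ext
  · simp; ring
  · simp

/-- Multiply f by the measurable phase φ = conj(E f)/|E f|, which is read as 0 where E f = 0. Then
|E f| = E(Re(φ f)), and this is at most E(|f|). -/
lemma enorm_condE_le (hm : m ≤ m0) [SigmaFinite (μ.trim hm)] {f : X → ℂ}
    (hfm : AEMeasurable[m0] f μ) (hf : Conditionable m μ f) :
    ∀ᵐ x ∂μ, ‖condE m μ f x‖ₑ ≤ condLExp m μ (fun y => ‖f y‖ₑ) x := by
  set φ : X → ℂ := fun x => conj (condE m μ f x) / (‖condE m μ f x‖ : ℂ) with hφ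
  have hb := measurable_condE m μ f
  have hφm : Measurable[m] φ := (Complex.continuous_conj.measurable.comp hb).div
    (Complex.measurable_ofReal.comp (measurable_norm.comp hb))
  have hφ1 : ∀ x, ‖φ x‖ ≤ 1 := fun x => by
    simp only [hφ, norm_div, RCLike.norm_conj, Complex.norm_real, norm_norm]
    exact div_self_le_one _
  have h1 : ∀ᵐ x ∂μ, condLExp m μ (fun y => ENNReal.ofReal (φ y * f y).re) x ≤
      condLExp m μ (fun y => ‖f y‖ₑ) x := condLExp_mono (ae_of_all _ fun x => by
    change ENNReal.ofReal _ ≤ ‖f x‖ₑ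
    rw [← ofReal_norm]
    refine ENNReal.ofReal_le_ofReal ((Complex.re_le_norm _).trans ?_)
    rw [norm_mul]
    exact mul_le_of_le_one_left (norm_nonneg _) (hφ1 x))
  filter_upwards [condE_mul hm hφm hfm hf, h1, hf] with x e h1 h2
  have e' : φ x * condE m μ f x = (‖condE m μ f x‖ : ℂ) := by
    simp only [hφ]
    by_cases h0 : condE m μ f x = 0
    · simp [h0]
    · rw [div_mul_eq_mul_div, div_eq_iff (by simpa using h0), Complex.conj_mul', pow_two]
  rw [e'] at e
  have e3 := congrArg Complex.re e
  simp only [condE, Complex.add_re, Complex.ofReal_re, Complex.re_ofReal_mul, Complex.I_re,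
    mul_zero, add_zero] at e3
  rw [← ofReal_norm]
  refine ENNReal.ofReal_le_of_le_toReal ?_
  simp only [condE]
  rw [← e3, condERe]
  have := ENNReal.toReal_mono h2.ne h1
  have := ENNReal.toReal_nonneg (a := condLExp m μ (fun y => ENNReal.ofReal (-(φ y * f y).re)) x)
  linarith

lemma integrable_condERe (hm : m ≤ m0) [SigmaFinite (μ.trim hm)] {f : X → ℝ}
    (hf : Integrable f μ) :
    Integrable (condERe m μ f) μ ∧ ∫ x, condERe m μ f x ∂μ = ∫ x, f x ∂μ := by
  have fin : ∀ {f : X → ℝ}, Integrable f μ →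
      ∫⁻ x, condLExp m μ (fun y => ENNReal.ofReal (f y)) x ∂μ ≠ ∞ := fun {f} hf => by
    rw [lintegral_condLExp hm]
    exact (hf.lintegral_lt_top).ne
  have hi : ∀ {f : X → ℝ}, Integrable f μ →
      Integrable (fun x => (condLExp m μ (fun y => ENNReal.ofReal (f y)) x).toReal) μ :=
    fun {f} hf => integrable_toReal_of_lintegral_ne_top
      (measurable_condLExp' m μ _).aemeasurable (fin hf)
  have he : ∀ {f : X → ℝ}, Integrable f μ →
      ∫ x, (condLExp m μ (fun y => ENNReal.ofReal (f y)) x).toReal ∂μ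
        = (∫⁻ x, ENNReal.ofReal (f x) ∂μ).toReal := fun {f} hf => by
    rw [integral_toReal (measurable_condLExp' m μ _).aemeasurable
      (ae_lt_top' (measurable_condLExp' m μ _).aemeasurable (fin hf)), lintegral_condLExp hm]
  refine ⟨(hi hf).sub (hi hf.neg), ?_⟩
  simp only [condERe]
  have e := integral_sub (hi hf) (hi hf.neg)
  have e' := he hf.neg
  simp only [Pi.neg_apply] at e e'
  rw [e, e', he hf, integral_eq_lintegral_pos_part_sub_lintegral_neg_part hf]

lemma integral_condE (hm : m ≤ m0) [SigmaFinite (μ.trim hm)] {f : X → ℂ}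
    (hf : Integrable f μ) : ∫ x, condE m μ f x ∂μ = ∫ x, f x ∂μ := by
  obtain ⟨i1, e1⟩ := integrable_condERe hm hf.re
  obtain ⟨i2, e2⟩ := integrable_condERe hm hf.im
  simp only [RCLike.re_to_complex, RCLike.im_to_complex] at i1 i2 e1 e2
  simp only [condE]
  rw [integral_add i1.ofReal (i2.ofReal.mul_const _), integral_mul_const, integral_complex_ofReal,
    integral_complex_ofReal, e1, e2, ← integral_re_add_im hf]
  rfl

lemma integrable_condE (hm : m ≤ m0) [SigmaFinite (μ.trim hm)] {f : X → ℂ}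
    (hf : Integrable f μ) : Integrable (condE m μ f) μ :=
  (integrable_condERe hm hf.re).1.ofReal.add ((integrable_condERe hm hf.im).1.ofReal.mul_const _)

end CondExpTools

/-! ### Square integrals and bounded multiplication operators on L². -/

section Multiplication

variable {X : Type*} {m0 : MeasurableSpace X} {μ : Measure[m0] X}

lemma eLpNorm_two_sq (f : X → ℂ) : eLpNorm f 2 μ ^ 2 = ∫⁻ x, ‖f x‖ₑ ^ 2 ∂μ := by
  have := eLpNorm_nnreal_pow_eq_lintegral (f := f) (μ := μ) (p := 2) two_ne_zero
  simpa using this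

lemma memLp_two_iff {f : X → ℂ} (hf : AEStronglyMeasurable f μ) :
    MemLp f 2 μ ↔ ∫⁻ x, ‖f x‖ₑ ^ 2 ∂μ < ∞ := by
  rw [← eLpNorm_two_sq, MemLp, and_iff_right hf]
  simp [lt_top_iff_ne_top]

lemma tendsto_toLp_zero {F : ℕ → X → ℂ} (hF : ∀ n, MemLp (F n) 2 μ)
    (h : Tendsto (fun n => ∫⁻ x, ‖F n x‖ₑ ^ 2 ∂μ) atTop (𝓝 0)) :
    Tendsto (fun n => (hF n).toLp (F n)) atTop (𝓝 0) := by
  rw [tendsto_zero_iff_norm_tendsto_zero]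
  have h1 : Tendsto (fun n => (eLpNorm (F n) 2 μ ^ 2) ^ (2⁻¹ : ℝ)) atTop (𝓝 (0 ^ (2⁻¹ : ℝ))) := by
    simp only [eLpNorm_two_sq]
    exact h.ennrpow_const _
  simp only [← ENNReal.rpow_natCast, ← ENNReal.rpow_mul] at h1
  norm_num at h1
  have h2 := (ENNReal.tendsto_toReal ENNReal.zero_ne_top).comp h1
  simpa [Lp.norm_toLp, Function.comp_def] using h2

/-- Multiplication by an essentially bounded real function on `L²`. -/
def mulL (φ : X → ℝ) (hφ : MemLp (fun x => (φ x : ℂ)) ∞ μ) : Lp ℂ 2 μ →L[ℂ] Lp ℂ 2 μ :=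
  (ContinuousLinearMap.mul ℂ ℂ).holderL μ ∞ 2 2 hφ.toLp

lemma coeFn_mulL {φ : X → ℝ} (hφ : MemLp (fun x => (φ x : ℂ)) ∞ μ) (f : Lp ℂ 2 μ) :
    mulL φ hφ f =ᵐ[μ] fun x => (φ x : ℂ) * f x := by
  filter_upwards [(ContinuousLinearMap.mul ℂ ℂ).coeFn_holder (r := 2) hφ.toLp f,
    hφ.coeFn_toLp] with x h1 h2
  rw [mulL, ContinuousLinearMap.holderL_apply_apply, h1, h2]
  rfl

end Multiplication

/-! ### The graph of M_wEM_u, and what density and closedness force on the weights. -/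

section Graph

variable {X : Type*} {m m0 : MeasurableSpace X} {μ : Measure[m0] X} {w u : X →ₘ[μ] ℂ}

lemma mem_graph_wct {f g : Lp ℂ 2 μ} : (f, g) ∈ (wct m μ w u).graph ↔
    Conditionable m μ (fun x => u x * f x) ∧ g =ᵐ[μ] wctFun m μ w u f := by
  rw [graph_mem_iff]
  constructor
  · rintro ⟨hf, rfl⟩
    exact ⟨hf.1, MemLp.coeFn_toLp hf.2⟩
  · rintro ⟨h1, h2⟩
    have h3 : MemLp (wctFun m μ w u f) 2 μ := (Lp.memLp g).ae_eq h2
    exact ⟨⟨h1, h3⟩, Lp.ext (h3.coeFn_toLp.trans h2.symm)⟩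

variable (hm : m ≤ m0) [SigmaFinite (μ.trim hm)]
include hm

lemma graph_wct_mul {φ : X → ℝ} (hφ : Measurable[m] φ) {f g f' g' : Lp ℂ 2 μ}
    (h : (f, g) ∈ (wct m μ w u).graph) (hf : f' =ᵐ[μ] fun x => (φ x : ℂ) * f x)
    (hg : g' =ᵐ[μ] fun x => (φ x : ℂ) * g x) : (f', g') ∈ (wct m μ w u).graph := by
  obtain ⟨h1, h2⟩ := mem_graph_wct.1 h
  have e : (fun x => u x * f' x) =ᵐ[μ] fun x => (φ x : ℂ) * (u x * f x) := by
    filter_upwards [hf] with x hx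
    rw [hx, mul_left_comm]
  have hφ' : Measurable[m] fun x => (φ x : ℂ) := Complex.measurable_ofReal.comp hφ
  refine mem_graph_wct.2 ⟨(h1.mul hm hφ' (aemeasurable_mul_Lp u f)).congr e.symm, ?_⟩
  filter_upwards [hg, h2, condE_congr (m := m) e,
    condE_ofReal_mul hm hφ (aemeasurable_mul_Lp u f)] with x h1 h2 h3 h4
  rw [h1, h2, wctFun, wctFun, h3, h4, mul_left_comm]

/-- With a = E(uf), the pull-out rule gives ∫ |a|² E(|w|²) = ∫ |w a|² = ‖g‖² < ∞, so a cannot be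
nonzero on a set of positive measure where E(|w|²) = ∞. -/
lemma condE_eq_zero_of_condSq_eq_top {f g : Lp ℂ 2 μ} (h : (f, g) ∈ (wct m μ w u).graph) :
    ∀ᵐ x ∂μ, condSq m μ w x = ∞ → condE m μ (fun y => u y * f y) x = 0 := by
  set a := condE m μ (fun y => u y * f y) with ha
  have hfin : ∫⁻ x, ‖a x‖ₑ ^ 2 * condSq m μ w x ∂μ < ∞ := by
    have ham : Measurable[m] fun x => ‖a x‖ₑ ^ 2 :=
      (measurable_enorm.comp (measurable_condE m μ _)).pow_const 2
    rw [condSq, lintegral_mul_condLExp hm ham (w.aemeasurable.enorm.pow_const 2)]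
    refine lt_of_eq_of_lt (lintegral_congr_ae ?_)
      ((memLp_two_iff (Lp.aestronglyMeasurable g)).1 (Lp.memLp g))
    filter_upwards [(mem_graph_wct.1 h).2] with x hx
    rw [hx, wctFun, enorm_mul, mul_pow, mul_comm]
  have hmeas : AEMeasurable (fun x => ‖a x‖ₑ ^ 2 * condSq m μ w x) μ :=
    (((measurable_condE m μ _).mono hm le_rfl).enorm.pow_const 2).aemeasurable.mul
      (measurable_condLExp' m μ _).aemeasurable
  filter_upwards [ae_lt_top' hmeas hfin.ne] with x hx hW
  by_contra h0
  rw [hW, ENNReal.mul_top (by simpa using h0)] at hx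
  exact hx.ne rfl

omit hm [SigmaFinite (μ.trim hm)] in
lemma condE_toReal {g : X → ℝ≥0∞} (hg : ∀ x, g x ≠ ∞) :
    condE m μ (fun x => ((g x).toReal : ℂ)) = fun x => ((condLExp m μ g x).toReal : ℂ) := by
  have h0 : condLExp m μ (fun _ : X => (0 : ℝ≥0∞)) = 0 := condLExp_zero μ
  ext x
  simp [condE, condERe, ENNReal.ofReal_toReal (hg _), h0,
    ENNReal.ofReal_of_nonpos (neg_nonpos.2 ENNReal.toReal_nonneg)]

lemma condSq_eq_zero_of_ae {s : Set X} (hs : MeasurableSet[m] s)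
    (h : ∀ᵐ x ∂μ, x ∈ s → u x = 0) : ∀ᵐ x ∂μ, x ∈ s → condSq m μ u x = 0 := by
  have h1 : ∫⁻ x in s, condSq m μ u x ∂μ = 0 := by
    rw [condSq, setLIntegral_condLExp hm μ _ hs, setLIntegral_eq_zero_iff' (hm s hs)
      (u.aemeasurable.enorm.pow_const 2).restrict]
    filter_upwards [h] with x hx hxs
    simp [hx hxs]
  rwa [condSq, setLIntegral_eq_zero_iff (hm s hs) (measurable_condLExp' m μ _)] at h1

omit hm [SigmaFinite (μ.trim hm)] in
lemma aestronglyMeasurable_truncation (u : X →ₘ[μ] ℂ) (n : ℕ) :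
    AEStronglyMeasurable (fun x => if ‖u x‖ ≤ n then conj (u x) else 0) μ := by
  have e : (fun x => if ‖u x‖ ≤ n then conj (u x) else 0)
      = {x | ‖u x‖ ≤ n}.indicator (fun x => conj (u x)) := by
    ext x; simp [Set.indicator]
  rw [e]
  exact (Complex.continuous_conj.comp_aestronglyMeasurable u.aestronglyMeasurable).indicator₀
    (nullMeasurableSet_le u.aemeasurable.norm aemeasurable_const)

lemma truncation_memLp (u : X →ₘ[μ] ℂ) (n k : ℕ) :
    MemLp (fun x => (spanningSets (μ.trim hm) k).indicator
      (fun x => if ‖u x‖ ≤ n then conj (u x) else 0) x) 2 μ := by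
  have hS : MeasurableSet[m] (spanningSets (μ.trim hm) k) := measurableSet_spanningSets _ k
  have hSfin : μ (spanningSets (μ.trim hm) k) < ∞ := by
    rw [← trim_measurableSet_eq hm hS]
    exact measure_spanningSets_lt_top _ k
  rw [memLp_indicator_iff_restrict (hm _ hS)]
  have : IsFiniteMeasure (μ.restrict (spanningSets (μ.trim hm) k)) := ⟨by simpa using hSfin⟩
  refine MemLp.of_bound (aestronglyMeasurable_truncation u n).restrict n (ae_of_all _ fun x => ?_)
  split_ifs with h
  · simpa using h
  · simp

/-- On A = {E(|w|²) = ∞} the function E(uf) vanishes for f in D(T), so T(1_A f) = 0. By density and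
closedness (1_A g, 0) is in the graph for every g in L². Hence E(ug) = 0 on A, and truncations of ū
as g turn this into u = 0 on A. -/
lemma eq_zero_of_condSq_eq_top (hd : Dense ((wct m μ w u).domain : Set (Lp ℂ 2 μ)))
    (hc : (wct m μ w u).IsClosed) : ∀ᵐ x ∂μ, condSq m μ w x = ∞ → u x = 0 := by
  classical
  set A : Set X := {x | condSq m μ w x = ∞} with hA
  have hAm : MeasurableSet[m] A := measurable_condLExp m μ _ (measurableSet_singleton ∞)
  set φ : X → ℝ := A.indicator 1 with hφ
  have hφm : Measurable[m] φ := measurable_const.indicator hAm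
  have hφL : MemLp (fun x => (φ x : ℂ)) ∞ μ := by
    refine memLp_top_of_bound (Complex.measurable_ofReal.comp
      (hφm.mono hm le_rfl)).aestronglyMeasurable 1 (ae_of_all _ fun x => ?_)
    by_cases hx : x ∈ A <;> simp [hφ, hx]
  have h1 : ∀ g : Lp ℂ 2 μ, (mulL φ hφL g, (0 : Lp ℂ 2 μ)) ∈ (wct m μ w u).graph := by
    intro g
    refine hd.induction (P := fun g => (mulL φ hφL g, (0 : Lp ℂ 2 μ)) ∈ (wct m μ w u).graph)
      (fun f hf => ?_) (hc.preimage (by fun_prop)) g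
    have hg := (wct m μ w u).mem_graph ⟨f, hf⟩
    refine graph_wct_mul hm hφm hg (coeFn_mulL hφL f) ?_
    filter_upwards [Lp.coeFn_zero ℂ 2 μ, (mem_graph_wct.1 hg).2,
      condE_eq_zero_of_condSq_eq_top hm hg] with x h1 h2 h3
    rw [h1, h2, wctFun]
    by_cases hx : x ∈ A
    · rw [h3 hx]; simp
    · simp [hφ, hx]
  have h2 : ∀ g : Lp ℂ 2 μ, ∀ᵐ x ∂μ, x ∈ A → condE m μ (fun y => u y * g y) x = 0 := by
    intro g
    have e : (fun x => u x * mulL φ hφL g x) =ᵐ[μ] fun x => (φ x : ℂ) * (u x * g x) := by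
      filter_upwards [coeFn_mulL hφL g] with x hx
      rw [hx, mul_left_comm]
    filter_upwards [condE_eq_zero_of_condSq_eq_top hm (h1 g), condE_congr (m := m) e,
      condE_ofReal_mul hm hφm (aemeasurable_mul_Lp u g)] with x e1 e2 e3 hx
    rw [e2, e3] at e1
    simpa [hφ, hx] using e1 hx
  have h3 : ∀ n k : ℕ, ∀ᵐ x ∂μ, x ∈ A → x ∈ spanningSets (μ.trim hm) k → ‖u x‖ ≤ n →
      u x = 0 := by
    intro n k
    have hL := truncation_memLp hm u n k
    set h : X → ℂ := fun x => (spanningSets (μ.trim hm) k).indicator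
      (fun x => if ‖u x‖ ≤ n then conj (u x) else 0) x with hh
    have e1 : (fun x => u x * hL.toLp h x) =ᵐ[μ] fun x => ((‖h x‖ₑ ^ 2).toReal : ℂ) := by
      filter_upwards [hL.coeFn_toLp] with x hx
      rw [hx]
      have e0 : u x * h x = conj (h x) * h x := by
        simp only [hh]
        by_cases hs : x ∈ spanningSets (μ.trim hm) k <;> by_cases hn : ‖u x‖ ≤ n <;>
          simp [hs, hn]
      rw [e0, Complex.conj_mul']
      simp
    have hint := (memLp_two_iff hL.1).1 hL
    have e2 : ∫⁻ x in A, ‖h x‖ₑ ^ 2 ∂μ = 0 := by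
      rw [← setLIntegral_condLExp hm μ _ hAm, setLIntegral_eq_zero_iff (hm A hAm)
        (measurable_condLExp' m μ _)]
      filter_upwards [h2 (hL.toLp h), condE_congr (m := m) e1,
        condLExp_lt_top (mΩ := m) hint.ne] with x h1 h2 h3 hx
      have h4 := h1 hx
      rw [h2, condE_toReal (fun x => by finiteness), Complex.ofReal_eq_zero,
        ENNReal.toReal_eq_zero_iff] at h4
      -- `ENNReal.toReal` also sends ∞ to 0; that case is excluded because |h|² is integrable.
      exact h4.resolve_right h3.ne
    rw [setLIntegral_eq_zero_iff' (hm A hAm) (hL.1.aemeasurable.enorm.pow_const 2).restrict] at e2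
    filter_upwards [e2] with x hx hxA hxS hxn
    simpa [hh, hxS, hxn] using hx hxA
  have h4 : ∀ᵐ x ∂μ, ∀ n k : ℕ, x ∈ A → x ∈ spanningSets (μ.trim hm) k → ‖u x‖ ≤ n → u x = 0 :=
    ae_all_iff.2 fun n => ae_all_iff.2 fun k => h3 n k
  filter_upwards [h4] with x hx hxA
  obtain ⟨n, hn⟩ := exists_nat_ge ‖u x‖
  obtain ⟨k, hk⟩ : ∃ k, x ∈ spanningSets (μ.trim hm) k := by
    have : x ∈ ⋃ i, spanningSets (μ.trim hm) i := by rw [iUnion_spanningSets]; trivial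
    exact Set.mem_iUnion.1 this
  exact hx n k hxA hk hn

/-- Where `E(|u|²) = ∞`, closability of `M_w E M_u` forces `w = 0`: truncations of `ū`,
normalised by `1 + E(|u|² 1_{|u| ≤ n})`, tend to `0` while their images tend to `w`. -/
lemma eq_zero_of_condSq_eq_top_right (hd : Dense ((wct m μ w u).domain : Set (Lp ℂ 2 μ)))
    (hc : (wct m μ w u).IsClosed) : ∀ᵐ x ∂μ, condSq m μ u x = ∞ → w x = 0 := by
  classical
  set V : ℕ → X → ℝ≥0∞ := fun n =>
    condLExp m μ (fun x => if ‖u x‖ ≤ n then ‖u x‖ₑ ^ 2 else 0) with hV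
  set s : ℕ → X → ℝ≥0∞ := fun n x => (1 + V n x)⁻¹ with hs
  have hsm : ∀ n, Measurable[m] (s n) := fun n =>
    (measurable_const.add (measurable_condLExp m μ _)).inv
  have hs1 : ∀ n x, s n x ≤ 1 := fun n x => ENNReal.inv_le_one.2 le_self_add
  have hset : ∀ n : ℕ, NullMeasurableSet {x | ‖u x‖ ≤ n} μ := fun n =>
    nullMeasurableSet_le u.aemeasurable.norm aemeasurable_const
  have hgm : ∀ n : ℕ, AEMeasurable (fun x => if ‖u x‖ ≤ n then ‖u x‖ₑ ^ 2 else 0) μ := fun n => by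
    have e : (fun x => if ‖u x‖ ≤ n then ‖u x‖ₑ ^ 2 else 0)
        = {x | ‖u x‖ ≤ n}.indicator (fun x => ‖u x‖ₑ ^ 2) := by
      ext x; simp [Set.indicator]
    rw [e]
    exact (u.aemeasurable.enorm.pow_const 2).indicator₀ (hset n)
  have hmono : Monotone fun (n : ℕ) x => if ‖u x‖ ≤ n then ‖u x‖ₑ ^ 2 else 0 := by
    intro i j hij x
    have : (i : ℝ) ≤ j := by exact_mod_cast hij
    by_cases h : ‖u x‖ ≤ i
    · simp [h, h.trans this]
    · simp [h]
  have hVmono : ∀ᵐ x ∂μ, Monotone fun n => V n x := by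
    have : ∀ᵐ x ∂μ, ∀ n, V n x ≤ V (n + 1) x := ae_all_iff.2 fun n =>
      condLExp_mono (ae_of_all _ (hmono n.le_succ))
    exact this.mono fun x hx => monotone_nat_of_le_succ hx
  have hVsup : ∀ᵐ x ∂μ, condSq m μ u x = ⨆ n, V n x := by
    have e : (fun x => ‖u x‖ₑ ^ 2) = fun x => ⨆ n : ℕ, if ‖u x‖ ≤ n then ‖u x‖ₑ ^ 2 else 0 := by
      ext x
      apply le_antisymm
      · obtain ⟨n, hn⟩ := exists_nat_ge ‖u x‖
        refine le_iSup_of_le n ?_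
        simp [hn]
      · exact iSup_le fun n => by split_ifs <;> simp
    rw [condSq, e]
    exact condLExp_iSup hm hgm hmono
  have hslim : ∀ᵐ x ∂μ, condSq m μ u x = ∞ → Tendsto (fun n => s n x) atTop (𝓝 0) := by
    filter_upwards [hVmono, hVsup] with x h1 h2 h3
    have h4 := tendsto_atTop_iSup h1
    rw [← h2, h3] at h4
    have h5 := (tendsto_inv_iff.2 (tendsto_const_nhds.add h4 : Tendsto
      (fun n => 1 + V n x) atTop (𝓝 (1 + ∞))))
    simpa using h5
  have key : ∀ k : ℕ, ∀ᵐ x ∂μ, condSq m μ u x = ∞ → condSq m μ w x ≤ k →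
      x ∈ spanningSets (μ.trim hm) k → w x = 0 := by
    intro k
    -- On C the measure and ∫|w|² are both finite, so 1 and |w|² can serve as dominating functions.
    -- One index k controls both the bound on E(|w|²) and the exhausting set.
    set C : Set X := {x | condSq m μ u x = ∞} ∩ {x | condSq m μ w x ≤ k}
      ∩ spanningSets (μ.trim hm) k with hC
    have hSm : MeasurableSet[m] (spanningSets (μ.trim hm) k) := measurableSet_spanningSets _ k
    have hCm : MeasurableSet[m] C :=
      ((measurable_condLExp m μ _ (measurableSet_singleton ∞)).inter
        (measurable_condLExp m μ _ measurableSet_Iic)).inter hSm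
    have hCfin : μ C < ∞ := by
      refine (measure_mono Set.inter_subset_right).trans_lt ?_
      rw [← trim_measurableSet_eq hm hSm]
      exact measure_spanningSets_lt_top _ k
    set ρ : ℕ → X → ℝ := fun n => C.indicator fun x => (s n x).toReal with hρ
    have hρm : ∀ n, Measurable[m] (ρ n) := fun n => (hsm n).ennreal_toReal.indicator hCm
    have hρe : ∀ n x, ‖(ρ n x : ℂ)‖ₑ = C.indicator (s n) x := fun n x => by
      have : s n x ≠ ∞ := ((hs1 n x).trans_lt ENNReal.one_lt_top).ne
      by_cases hx : x ∈ C
      · simp only [hρ, Set.indicator_of_mem hx]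
        rw [← ofReal_norm, Complex.norm_real, Real.norm_of_nonneg ENNReal.toReal_nonneg,
          ENNReal.ofReal_toReal this]
      · simp [hρ, hx]
    have hwC : ∫⁻ x in C, ‖w x‖ₑ ^ 2 ∂μ < ∞ := by
      rw [← setLIntegral_condLExp hm μ _ hCm]
      refine (setLIntegral_mono measurable_const (g := fun _ => (k : ℝ≥0∞))
        fun x hx => hx.1.2).trans_lt ?_
      rw [setLIntegral_const]
      exact ENNReal.mul_lt_top (by finiteness) hCfin
    have hwL : MemLp (C.indicator w) 2 μ := by
      rw [memLp_indicator_iff_restrict (hm _ hCm), memLp_two_iff w.aestronglyMeasurable.restrict]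
      exact hwC
    set F : ℕ → X → ℂ := fun n x => (ρ n x : ℂ) * if ‖u x‖ ≤ n then conj (u x) else 0 with hF
    have hFm : ∀ n, AEStronglyMeasurable (F n) μ := fun n => by
      refine (Complex.measurable_ofReal.comp ((hρm n).mono hm le_rfl)).aestronglyMeasurable.mul ?_
      exact aestronglyMeasurable_truncation u n
    have hFle : ∀ n, ∫⁻ x, ‖F n x‖ₑ ^ 2 ∂μ ≤ ∫⁻ x in C, s n x ∂μ := fun n => by
      have e1 : ∀ x, ‖F n x‖ₑ ^ 2 = (C.indicator (s n) x) ^ 2 *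
          (if ‖u x‖ ≤ n then ‖u x‖ₑ ^ 2 else 0) := fun x => by
        simp only [hF, enorm_mul, mul_pow, hρe]
        split_ifs <;> simp
      simp only [e1]
      rw [← lintegral_mul_condLExp hm (((hsm n).indicator hCm).pow_const 2) (hgm n),
        ← lintegral_indicator (hm _ hCm)]
      refine lintegral_mono fun x => ?_
      by_cases hx : x ∈ C
      · simp only [Set.indicator_of_mem hx]
        -- The norm bound uses only s_n V_n ≤ 1, which leaves one factor s_n to tend to 0.
        calc s n x ^ 2 * V n x = s n x * (s n x * V n x) := by ring
          _ ≤ s n x * ((1 + V n x)⁻¹ * (1 + V n x)) := by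
            gcongr
            exact le_add_self
          _ ≤ s n x * 1 := by gcongr; exact ENNReal.inv_mul_le_one _
          _ = s n x := mul_one _
      · simp [hx]
    have hF2 : ∀ n, MemLp (F n) 2 μ := fun n => by
      refine (memLp_two_iff (hFm n)).2 ((hFle n).trans_lt ?_)
      refine (setLIntegral_mono measurable_const (g := fun _ => 1) fun x _ => hs1 n x).trans_lt ?_
      simpa using hCfin
    set G : ℕ → X → ℂ := fun n x => (ρ n x : ℂ) * C.indicator w x with hG
    have hGm : ∀ n, AEStronglyMeasurable (G n) μ := fun n =>
      (Complex.measurable_ofReal.comp ((hρm n).mono hm le_rfl)).aestronglyMeasurable.mul hwL.1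
    have hGe : ∀ n x, ‖G n x‖ₑ ^ 2 = C.indicator (fun x => s n x ^ 2 * ‖w x‖ₑ ^ 2) x :=
      fun n x => by
        simp only [hG, enorm_mul, mul_pow, hρe]
        by_cases hx : x ∈ C <;> simp [hx]
    have hG2 : ∀ n, MemLp (G n) 2 μ := fun n => by
      refine (memLp_two_iff (hGm n)).2 ?_
      simp only [hGe]
      rw [lintegral_indicator (hm _ hCm)]
      refine (lintegral_mono fun x => ?_).trans_lt hwC
      exact mul_le_of_le_one_left' (pow_le_one' (hs1 n x) 2)
    have hslimC : ∀ᵐ x ∂μ.restrict C, Tendsto (fun n => s n x) atTop (𝓝 0) := by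
      filter_upwards [ae_restrict_of_ae hslim, ae_restrict_mem (hm _ hCm)] with x h1 h2
      exact h1 h2.1.1
    have hFlim : Tendsto (fun n => (hF2 n).toLp (F n)) atTop (𝓝 0) := by
      refine tendsto_toLp_zero hF2 (tendsto_of_tendsto_of_tendsto_of_le_of_le tendsto_const_nhds ?_
        (fun n => zero_le) hFle)
      have := tendsto_lintegral_of_dominated_convergence (μ := μ.restrict C) (F := s)
        (f := fun _ => 0) (fun _ => 1) (fun n => (hsm n).mono hm le_rfl)
        (fun n => ae_of_all _ (hs1 n)) (by simpa using hCfin.ne) hslimC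
      simpa using this
    have hGlim : Tendsto (fun n => (hG2 n).toLp (G n)) atTop (𝓝 0) := by
      refine tendsto_toLp_zero hG2 ?_
      simp only [hGe]
      simp only [lintegral_indicator (hm _ hCm)]
      have := tendsto_lintegral_of_dominated_convergence' (μ := μ.restrict C)
        (F := fun n x => s n x ^ 2 * ‖w x‖ₑ ^ 2)
        (f := fun _ => 0) (fun x => ‖w x‖ₑ ^ 2)
        (fun n => (((hsm n).mono hm le_rfl).pow_const 2).aemeasurable.mul
          (w.aemeasurable.enorm.pow_const 2).restrict)
        (fun n => ae_of_all _ fun x => mul_le_of_le_one_left' (pow_le_one' (hs1 n x) 2))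
        hwC.ne (by
          filter_upwards [hslimC] with x hx
          have h1 := ENNReal.Tendsto.mul_const (b := ‖w x‖ₑ ^ 2)
            ((ENNReal.continuous_pow 2).tendsto 0 |>.comp hx) (Or.inr (by finiteness))
          simpa [Function.comp_def] using h1)
      simpa using this
    -- On C one has E(u F_n) = s_n V_n = 1 - s_n, so the image of F_n is 1_C w minus the vanishing
    -- term G_n.
    have hgraph : ∀ n, ((hF2 n).toLp (F n), hwL.toLp _ - (hG2 n).toLp (G n))
        ∈ (wct m μ w u).graph := by
      intro n
      have hfin : ∀ x, (if ‖u x‖ ≤ n then ‖u x‖ₑ ^ 2 else 0) ≠ ∞ := fun x => by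
        split_ifs <;> finiteness
      have e1 : (fun x => u x * (hF2 n).toLp (F n) x) =ᵐ[μ] fun x =>
          (ρ n x : ℂ) * (((if ‖u x‖ ≤ n then ‖u x‖ₑ ^ 2 else 0 : ℝ≥0∞).toReal : ℝ) : ℂ) := by
        filter_upwards [(hF2 n).coeFn_toLp] with x hx
        rw [hx]
        simp only [hF]
        split_ifs with h
        · rw [mul_left_comm, Complex.mul_conj']
          simp
        · simp
      have hVb : ∀ᵐ x ∂μ, V n x < ∞ := by
        have : ∀ᵐ x ∂μ, V n x ≤ condLExp m μ (fun _ => (n : ℝ≥0∞) ^ 2) x :=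
          condLExp_mono (ae_of_all _ fun x => by
            change (if ‖u x‖ ≤ n then ‖u x‖ₑ ^ 2 else 0) ≤ (n : ℝ≥0∞) ^ 2
            split_ifs with h
            · gcongr
              rw [← ofReal_norm]
              exact ENNReal.ofReal_le_of_le_toReal (by simpa using h)
            · exact zero_le)
        filter_upwards [this] with x hx
        rw [condLExp_const hm] at hx
        exact hx.trans_lt (by finiteness)
      have hcond : Conditionable m μ fun x =>
          (((if ‖u x‖ ≤ n then ‖u x‖ₑ ^ 2 else 0 : ℝ≥0∞).toReal : ℝ) : ℂ) := by
        have e : (fun x => ‖(((if ‖u x‖ ≤ n then ‖u x‖ₑ ^ 2 else 0 : ℝ≥0∞).toReal : ℝ) : ℂ)‖ₑ)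
            = fun x => if ‖u x‖ ≤ n then ‖u x‖ₑ ^ 2 else 0 := by
          ext x
          rw [← ofReal_norm, Complex.norm_real, Real.norm_of_nonneg ENNReal.toReal_nonneg,
            ENNReal.ofReal_toReal (hfin x)]
        rw [Conditionable, e]
        exact hVb
      have hgm' : AEMeasurable (fun x =>
          (((if ‖u x‖ ≤ n then ‖u x‖ₑ ^ 2 else 0 : ℝ≥0∞).toReal : ℝ) : ℂ)) μ :=
        Complex.measurable_ofReal.comp_aemeasurable (hgm n).ennreal_toReal
      refine mem_graph_wct.2 ⟨(hcond.mul hm (Complex.measurable_ofReal.comp (hρm n)) hgm').congr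
        e1.symm, ?_⟩
      filter_upwards [Lp.coeFn_sub (hwL.toLp _) ((hG2 n).toLp (G n)), hwL.coeFn_toLp,
        (hG2 n).coeFn_toLp, condE_congr (m := m) e1, condE_ofReal_mul hm (hρm n) hgm', hVb]
        with x h1 h2 h3 h4 h5 h6
      rw [h1, Pi.sub_apply, h2, h3, wctFun, h4, h5, condE_toReal hfin]
      simp only [hG, hρ]
      by_cases hx : x ∈ C
      · simp only [Set.indicator_of_mem hx]
        have h7 : (s n x).toReal * (1 + (V n x).toReal) = 1 := by
          rw [hs, ENNReal.toReal_inv, ENNReal.toReal_add (by finiteness) h6.ne,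
            ENNReal.toReal_one]
          exact inv_mul_cancel₀ (by positivity)
        have h8 : ((s n x).toReal : ℂ) * (1 + ((V n x).toReal : ℂ)) = 1 := by exact_mod_cast h7
        linear_combination (-w x) * h8
      · simp [hx]
    have hlim : Tendsto (fun n => ((hF2 n).toLp (F n), hwL.toLp _ - (hG2 n).toLp (G n))) atTop
        (𝓝 ((0 : Lp ℂ 2 μ), hwL.toLp _ - 0)) :=
      hFlim.prodMk_nhds (tendsto_const_nhds.sub hGlim)
    -- Closedness puts (0, 1_C w) into the graph, and an operator graph over 0 contains only 0.
    have h0 := (wct m μ w u).graph_fst_eq_zero_snd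
      (hc.mem_of_tendsto hlim (Eventually.of_forall hgraph)) rfl
    rw [sub_zero] at h0
    have h1 := hwL.coeFn_toLp
    rw [h0] at h1
    filter_upwards [h1, Lp.coeFn_zero ℂ 2 μ] with x h1 h2 hu hw hS
    rw [h2, Set.indicator_of_mem (show x ∈ C from ⟨⟨hu, hw⟩, hS⟩)] at h1
    exact h1.symm
  have hA : MeasurableSet[m] {x | condSq m μ w x = ∞} :=
    measurable_condLExp m μ _ (measurableSet_singleton ∞)
  filter_upwards [ae_all_iff.2 key,
    condSq_eq_zero_of_ae hm hA (eq_zero_of_condSq_eq_top hm hd hc)] with x h1 h2 hu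
  -- The sets C miss the points with E(|w|²) = ∞, but there u = 0 and so E(|u|²) = 0, contrary to
  -- E(|u|²) = ∞.
  have hw : condSq m μ w x ≠ ∞ := fun h => by
    rw [h2 h] at hu
    exact ENNReal.zero_ne_top hu
  obtain ⟨k, hk⟩ : ∃ k, x ∈ spanningSets (μ.trim hm) k := by
    have : x ∈ ⋃ i, spanningSets (μ.trim hm) i := by rw [iUnion_spanningSets]; trivial
    exact Set.mem_iUnion.1 this
  obtain ⟨n, hn⟩ := ENNReal.exists_nat_gt hw
  refine h1 (max n k) hu (hn.le.trans ?_) (monotone_spanningSets _ (le_max_right n k) hk)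
  exact_mod_cast le_max_left n k

/-- Where one factor is ∞ the other is 0, and 0 · ∞ = 0. -/
lemma condSq_mul_condSq_lt_top (hd : Dense ((wct m μ w u).domain : Set (Lp ℂ 2 μ)))
    (hc : (wct m μ w u).IsClosed) : ∀ᵐ x ∂μ, condSq m μ w x * condSq m μ u x < ∞ := by
  have hA : MeasurableSet[m] {x | condSq m μ w x = ∞} :=
    measurable_condLExp m μ _ (measurableSet_singleton ∞)
  have hB : MeasurableSet[m] {x | condSq m μ u x = ∞} :=
    measurable_condLExp m μ _ (measurableSet_singleton ∞)
  filter_upwards [condSq_eq_zero_of_ae hm hA (eq_zero_of_condSq_eq_top hm hd hc),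
    condSq_eq_zero_of_ae hm hB (eq_zero_of_condSq_eq_top_right hm hd hc)] with x h1 h2
  by_cases hw : condSq m μ w x = ∞
  · simp [show condSq m μ u x = 0 from h1 hw]
  by_cases hu : condSq m μ u x = ∞
  · simp [show condSq m μ w x = 0 from h2 hu]
  exact ENNReal.mul_lt_top (lt_top_iff_ne_top.2 hw) (lt_top_iff_ne_top.2 hu)

end Graph

/-! ### The explicit solution t_λ ū E(w̄f) of the normal equation. -/

section Solution

variable {X : Type*} {m m0 : MeasurableSpace X} {μ : Measure[m0] X} {w u : X →ₘ[μ] ℂ}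

local notation "⟪" x "," y "⟫" => inner ℂ x y

/-- The weight `w`, cut off to the set where `E(|w|²) < ∞`. -/
def finWeight (m : MeasurableSpace X) {m0 : MeasurableSpace X} (μ : Measure[m0] X)
    (w : X → ℂ) : X → ℂ := {x | condSq m μ w x < ∞}.indicator w

/-- `E(w̄ f)`, with `w` cut off to the set where `E(|w|²) < ∞`. -/
def condConj (m : MeasurableSpace X) {m0 : MeasurableSpace X} (μ : Measure[m0] X)
    (w : X → ℂ) (f : X → ℂ) : X → ℂ := condE m μ (fun x => conj (finWeight m μ w x) * f x)

lemma measurable_condConj (m : MeasurableSpace X) {m0 : MeasurableSpace X} (μ : Measure[m0] X)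
    (w : X → ℂ) (f : X → ℂ) : Measurable[m] (condConj m μ w f) := measurable_condE m μ _

lemma measurableSet_condSq_lt_top (m : MeasurableSpace X) {m0 : MeasurableSpace X}
    (μ : Measure[m0] X) (w : X → ℂ) : MeasurableSet[m] {x | condSq m μ w x < ∞} :=
  measurable_condLExp m μ _ measurableSet_Iio

lemma measurable_tFun (m : MeasurableSpace X) {m0 : MeasurableSpace X} (μ : Measure[m0] X)
    (w u : X →ₘ[μ] ℂ) (lam : ℝ) : Measurable[m] (tFun m μ w u lam) :=
  measurable_const.div (measurable_const.add
    ((measurable_condLExp m μ _).mul (measurable_condLExp m μ _)).ennreal_toReal)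

section TFun

variable {lam : ℝ} (hlam : 0 < lam) (x : X)
include hlam

lemma tFun_pos : 0 < tFun m μ w u lam x := by
  rw [tFun]; positivity

lemma tFun_mul_add :
    tFun m μ w u lam x * (lam + (condSq m μ w x * condSq m μ u x).toReal) = 1 := by
  rw [tFun, one_div]
  exact inv_mul_cancel₀ (by positivity)

lemma tFun_le : tFun m μ w u lam x ≤ lam⁻¹ := by
  rw [tFun, one_div]
  exact inv_anti₀ hlam (le_add_of_nonneg_right ENNReal.toReal_nonneg)

lemma tFun_mul_le : tFun m μ w u lam x * (condSq m μ w x * condSq m μ u x).toReal ≤ 1 := by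
  have h1 := tFun_mul_add (m := m) (μ := μ) (w := w) (u := u) hlam x
  have h2 := tFun_pos (m := m) (μ := μ) (w := w) (u := u) hlam x
  nlinarith

end TFun

lemma memLp_top_tFun (hm : m ≤ m0) {lam : ℝ} (hlam : 0 < lam) :
    MemLp (fun x => (tFun m μ w u lam x : ℂ)) ∞ μ :=
  memLp_top_of_bound (Complex.measurable_ofReal.comp
    ((measurable_tFun m μ w u lam).mono hm le_rfl)).aestronglyMeasurable lam⁻¹
    (ae_of_all _ fun x => by
      rw [Complex.norm_real, Real.norm_of_nonneg (tFun_pos hlam x).le]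
      exact tFun_le hlam x)

variable (hm : m ≤ m0)
include hm

lemma aemeasurable_finWeight : AEMeasurable[m0] (finWeight m μ w) μ :=
  w.aemeasurable.indicator (hm _ (measurableSet_condSq_lt_top m μ w))

variable [SigmaFinite (μ.trim hm)]

lemma condSq_finWeight : condSq m μ (finWeight m μ w) =ᵐ[μ]
    {x | condSq m μ w x < ∞}.indicator (condSq m μ w) := by
  have hB := measurableSet_condSq_lt_top m μ w
  have e : (fun x => ‖finWeight m μ w x‖ₑ ^ 2) = fun x =>
      {x | condSq m μ w x < ∞}.indicator 1 x * ‖w x‖ₑ ^ 2 := by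
    ext x
    by_cases hx : condSq m μ w x < ∞ <;> simp [finWeight, hx]
  rw [condSq, e]
  filter_upwards [condLExp_mul hm (μ := μ) (φ := {x | condSq m μ w x < ∞}.indicator 1)
    (measurable_const.indicator hB) (w.aemeasurable.enorm.pow_const 2)] with x hx
  rw [hx]
  by_cases h : condSq m μ w x < ∞
  · simp only [Set.indicator_of_mem (show x ∈ {x | condSq m μ w x < ∞} from h), Pi.one_apply,
      one_mul]
    rfl
  · simp [h]

lemma condSq_finWeight_lt_top : ∀ᵐ x ∂μ, condSq m μ (finWeight m μ w) x < ∞ := by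
  filter_upwards [condSq_finWeight hm (w := w)] with x hx
  rw [hx]
  by_cases h : condSq m μ w x < ∞ <;> simp [h]

lemma conditionable_sq_finWeight :
    Conditionable m μ fun x => ((‖finWeight m μ w x‖ₑ ^ 2).toReal : ℂ) := by
  have e : (fun x => ‖((‖finWeight m μ w x‖ₑ ^ 2).toReal : ℂ)‖ₑ) =
      fun x => ‖finWeight m μ w x‖ₑ ^ 2 := by
    ext x
    rw [← ofReal_norm, Complex.norm_real, Real.norm_of_nonneg ENNReal.toReal_nonneg,
      ENNReal.ofReal_toReal (by finiteness)]
  rw [Conditionable, e]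
  exact condSq_finWeight_lt_top hm

/-- The cut-off makes w̄f conditionable for every f in L², by conditional Cauchy-Schwarz; without it
E(|w̄f|) may be infinite. -/
lemma enorm_condConj_sq_le (f : Lp ℂ 2 μ) :
    Conditionable m μ (fun x => conj (finWeight m μ w x) * f x) ∧
    ∀ᵐ x ∂μ, ‖condConj m μ w f x‖ₑ ^ 2 ≤ condSq m μ w x * condSq m μ f x := by
  have hw := aemeasurable_finWeight (w := w) hm
  have hwc : AEMeasurable (fun x => conj (finWeight m μ w x)) μ :=
    Complex.continuous_conj.measurable.comp_aemeasurable hw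
  have hf := (Lp.aestronglyMeasurable f).aemeasurable
  have hfin := condLExp_lt_top (mΩ := m)
    ((memLp_two_iff (Lp.aestronglyMeasurable f)).1 (Lp.memLp f)).ne
  have hcs := condLExp_mul_sq_le hm hwc hf
  have e : condSq m μ (fun x => conj (finWeight m μ w x)) = condSq m μ (finWeight m μ w) := by
    simp [condSq]
  rw [e] at hcs
  have hc : Conditionable m μ (fun x => conj (finWeight m μ w x) * f x) := by
    filter_upwards [hcs, condSq_finWeight_lt_top hm (w := w), hfin] with x h1 h2 h3
    have h4 := (h1 h2 h3).trans_lt (ENNReal.mul_lt_top h2 h3)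
    simpa using h4
  refine ⟨hc, ?_⟩
  filter_upwards [hcs, condSq_finWeight hm (w := w), condSq_finWeight_lt_top hm (w := w), hfin,
    enorm_condE_le hm (hwc.mul hf) hc] with x h1 h2 h3 h4 h5
  calc ‖condConj m μ w f x‖ₑ ^ 2
      ≤ condLExp m μ (fun x => ‖conj (finWeight m μ w x) * f x‖ₑ) x ^ 2 := by
        gcongr; exact h5
    _ ≤ condSq m μ (finWeight m μ w) x * condSq m μ f x := h1 h3 h4
    _ ≤ condSq m μ w x * condSq m μ f x := by
        gcongr
        rw [h2]
        exact Set.indicator_le_self _ _ x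

/-- `⟪T v, f⟫ = ∫ conj(E(u v)) E(w̄ f)`. -/
lemma inner_wct_eq_integral {v g : Lp ℂ 2 μ} (h : (v, g) ∈ (wct m μ w u).graph) (f : Lp ℂ 2 μ) :
    Integrable (fun x => conj (condE m μ (fun y => u y * v y) x) * condConj m μ w f x) μ ∧
    ⟪g, f⟫ = ∫ x, conj (condE m μ (fun y => u y * v y) x) * condConj m μ w f x ∂μ := by
  set a := condE m μ (fun y => u y * v y) with ha
  have ham : Measurable[m] fun x => conj (a x) :=
    Complex.continuous_conj.measurable.comp (measurable_condE m μ _)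
  have hq : AEMeasurable (fun x => conj (finWeight m μ w x) * f x) μ :=
    (Complex.continuous_conj.measurable.comp_aemeasurable (aemeasurable_finWeight hm)).mul
      (Lp.aestronglyMeasurable f).aemeasurable
  have e1 : (fun x => ⟪g x, f x⟫) =ᵐ[μ]
      fun x => conj (a x) * (conj (finWeight m μ w x) * f x) := by
    filter_upwards [(mem_graph_wct.1 h).2, condE_eq_zero_of_condSq_eq_top hm h] with x h1 h2
    rw [RCLike.inner_apply, h1, wctFun, map_mul]
    -- The cut-off of w loses nothing here, since E(uv) = 0 where E(|w|²) = ∞.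
    by_cases hx : condSq m μ w x < ∞
    · simp only [finWeight, Set.indicator_of_mem (show x ∈ {x | condSq m μ w x < ∞} from hx), ha]
      ring
    · have h3 := h2 (not_lt_top_iff.1 hx)
      simp [ha, h3]
  have hi : Integrable (fun x => conj (a x) * (conj (finWeight m μ w x) * f x)) μ :=
    (L2.integrable_inner g f).congr e1
  have e2 := condE_mul hm ham hq (enorm_condConj_sq_le hm f).1
  refine ⟨(integrable_condE hm hi).congr e2, ?_⟩
  rw [L2.inner_def, integral_congr_ae e1, ← integral_condE hm hi]
  exact integral_congr_ae e2

/-- Where the cut-off acts, u vanishes, so the factor ū hides whatever default value E(w̄f) takes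
there. -/
lemma conj_mul_condConj (hW : ∀ᵐ x ∂μ, condSq m μ w x = ∞ → u x = 0) (f : Lp ℂ 2 μ) :
    (fun x => conj (u x) * condConj m μ w f x) =ᵐ[μ]
      fun x => conj (u x) * condE m μ (fun y => conj (w y) * f y) x := by
  have hB := measurableSet_condSq_lt_top m μ w
  have e : (fun x => conj (finWeight m μ w x) * f x) = fun x =>
      (({x | condSq m μ w x < ∞}.indicator 1 x : ℝ) : ℂ) * (conj (w x) * f x) := by
    ext x
    by_cases hx : condSq m μ w x < ∞ <;> simp [finWeight, hx]
  have hq : AEMeasurable (fun x => conj (w x) * f x) μ :=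
    (Complex.continuous_conj.measurable.comp_aemeasurable w.aemeasurable).mul
      (Lp.aestronglyMeasurable f).aemeasurable
  filter_upwards [hW, condE_ofReal_mul hm (μ := μ) (φ := {x | condSq m μ w x < ∞}.indicator 1)
    (measurable_const.indicator hB) hq] with x h1 h2
  rw [condConj, e, h2]
  by_cases hx : condSq m μ w x < ∞
  · simp [hx]
  · simp [h1 (not_lt_top_iff.1 hx)]

/-- `u_λ = t_λ ū E(w̄ f)` lies in `D(T)` and `T u_λ = t_λ E(|u|²) w E(w̄ f)`. -/
lemma exists_regularised_graph (hN : ∀ᵐ x ∂μ, condSq m μ w x * condSq m μ u x < ∞)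
    {lam : ℝ} (hlam : 0 < lam) (f : Lp ℂ 2 μ) :
    ∃ z y : Lp ℂ 2 μ, (z, y) ∈ (wct m μ w u).graph ∧
      (z =ᵐ[μ] fun x => (tFun m μ w u lam x : ℂ) * (conj (u x) * condConj m μ w f x)) ∧
      (y =ᵐ[μ] fun x => w x * ((tFun m μ w u lam x : ℂ) *
        (((condSq m μ u x).toReal : ℂ) * condConj m μ w f x))) := by
  set t := tFun m μ w u lam with ht
  set b := condConj m μ w f with hb
  set V := condSq m μ u with hV
  set W := condSq m μ w with hWd
  have htm : Measurable[m] fun x => (t x : ℂ) :=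
    Complex.measurable_ofReal.comp (measurable_tFun m μ w u lam)
  have hbm : Measurable[m] b := measurable_condConj m μ w f
  have hVm : Measurable[m] V := measurable_condLExp m μ _
  have hVrm : Measurable[m] fun x => ((V x).toReal : ℂ) :=
    Complex.measurable_ofReal.comp hVm.ennreal_toReal
  have c : ∀ {ψ : X → ℂ}, Measurable[m] ψ → AEStronglyMeasurable[m0] ψ μ := fun h =>
    (h.mono hm le_rfl).aestronglyMeasurable
  have hffin : ∫⁻ x, condSq m μ f x ∂μ < ∞ := by
    rw [condSq, lintegral_condLExp hm]
    exact (memLp_two_iff (Lp.aestronglyMeasurable f)).1 (Lp.memLp f)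
  have hte : ∀ x, ‖(t x : ℂ)‖ₑ = ENNReal.ofReal (t x) := fun x => by
    rw [← ofReal_norm, Complex.norm_real, Real.norm_of_nonneg (tFun_pos hlam x).le]
  have hbV : ∀ᵐ x ∂μ, ‖b x‖ₑ ^ 2 * V x ≤ W x * V x * condSq m μ f x := by
    filter_upwards [(enorm_condConj_sq_le hm (w := w) f).2] with x hx
    calc ‖b x‖ₑ ^ 2 * V x ≤ W x * condSq m μ f x * V x := by gcongr
      _ = _ := by ring
  -- |b|²V is finite a.e., so b vanishes where V = ∞. Thus V.toReal = 0 is harmless there, and u may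
  -- be cut off in the computation of E(uz).
  have hb0 : ∀ᵐ x ∂μ, V x = ∞ → b x = 0 := by
    filter_upwards [hbV, hN, ae_lt_top ((measurable_condLExp' m μ _)) hffin.ne] with x h1 h2 h3 h4
    by_contra h0
    rw [h4, ENNReal.mul_top (by simpa using h0), ← h4] at h1
    exact absurd (h4 ▸ h1) (not_le.2 (ENNReal.mul_lt_top h2 h3))
  have htN : ∀ᵐ x ∂μ, ENNReal.ofReal (t x) * (W x * V x) ≤ 1 := by
    filter_upwards [hN] with x hx
    rw [← ENNReal.ofReal_toReal hx.ne, ← ENNReal.ofReal_mul (tFun_pos hlam x).le]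
    exact ENNReal.ofReal_le_one.2 (tFun_mul_le hlam x)
  have hzL : MemLp (fun x => (t x : ℂ) * (conj (u x) * b x)) 2 μ := by
    refine (memLp_two_iff ((c htm).mul ((Complex.continuous_conj.comp_aestronglyMeasurable
      u.aestronglyMeasurable).mul (c hbm)))).2 ?_
    have e : ∀ x, ‖(t x : ℂ) * (conj (u x) * b x)‖ₑ ^ 2 =
        (‖(t x : ℂ)‖ₑ ^ 2 * ‖b x‖ₑ ^ 2) * ‖u x‖ₑ ^ 2 := fun x => by
      rw [enorm_mul, enorm_mul, RCLike.enorm_conj]; ring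
    refine (lintegral_congr e).trans_lt ?_
    refine (lintegral_mul_condLExp hm (((measurable_enorm.comp htm).pow_const 2).mul
      ((measurable_enorm.comp hbm).pow_const 2))
      (u.aemeasurable.enorm.pow_const 2)).symm.trans_lt ?_
    -- After E replaces |u|² by V, the bound is t²|b|²V ≤ t · (tWV) · E(|f|²) ≤ λ⁻¹E(|f|²).
    refine (lintegral_mono_ae (g := fun x => ENNReal.ofReal lam⁻¹ * condSq m μ f x) ?_).trans_lt ?_
    · filter_upwards [hbV, htN] with x h1 h2
      change ‖(t x : ℂ)‖ₑ ^ 2 * ‖b x‖ₑ ^ 2 * V x ≤ ENNReal.ofReal lam⁻¹ * condSq m μ f x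
      rw [hte]
      calc ENNReal.ofReal (t x) ^ 2 * ‖b x‖ₑ ^ 2 * V x
          = ENNReal.ofReal (t x) ^ 2 * (‖b x‖ₑ ^ 2 * V x) := by ring
        _ ≤ ENNReal.ofReal (t x) ^ 2 * (W x * V x * condSq m μ f x) := by gcongr
        _ = ENNReal.ofReal (t x) * (ENNReal.ofReal (t x) * (W x * V x)) * condSq m μ f x := by ring
        _ ≤ ENNReal.ofReal lam⁻¹ * 1 * condSq m μ f x := by
            gcongr
            exact tFun_le hlam x
        _ = _ := by rw [mul_one]
    · rw [lintegral_const_mul' _ _ (by finiteness)]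
      exact ENNReal.mul_lt_top (by finiteness) hffin
  have hyL : MemLp (fun x => w x * ((t x : ℂ) * (((V x).toReal : ℂ) * b x))) 2 μ := by
    have hφ := htm.mul (hVrm.mul hbm)
    refine (memLp_two_iff (w.aestronglyMeasurable.mul (c hφ))).2 ?_
    have e : ∀ x, ‖w x * ((t x : ℂ) * (((V x).toReal : ℂ) * b x))‖ₑ ^ 2 =
        ‖(t x : ℂ) * (((V x).toReal : ℂ) * b x)‖ₑ ^ 2 * ‖w x‖ₑ ^ 2 := fun x => by
      rw [enorm_mul, mul_pow, mul_comm]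
    refine (lintegral_congr e).trans_lt ?_
    refine (lintegral_mul_condLExp hm ((measurable_enorm.comp hφ).pow_const 2)
      (w.aemeasurable.enorm.pow_const 2)).symm.trans_lt ?_
    -- Here the bound is t²V²|b|²W ≤ (tWV)² E(|f|²) ≤ E(|f|²).
    refine (lintegral_mono_ae (g := fun x => condSq m μ f x) ?_).trans_lt hffin
    filter_upwards [hbV, htN] with x h1 h2
    have hVr : ‖((V x).toReal : ℂ)‖ₑ ≤ V x := by
      rw [← ofReal_norm, Complex.norm_real, Real.norm_of_nonneg ENNReal.toReal_nonneg]
      exact ENNReal.ofReal_toReal_le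
    calc ‖(t x : ℂ) * (((V x).toReal : ℂ) * b x)‖ₑ ^ 2 * W x
        = ENNReal.ofReal (t x) ^ 2 * (‖((V x).toReal : ℂ)‖ₑ ^ 2 * ‖b x‖ₑ ^ 2) * W x := by
          rw [enorm_mul, enorm_mul, hte]; ring
      _ ≤ ENNReal.ofReal (t x) ^ 2 * (V x ^ 2 * ‖b x‖ₑ ^ 2) * W x := by gcongr
      _ = ENNReal.ofReal (t x) ^ 2 * (W x * V x) * (‖b x‖ₑ ^ 2 * V x) := by ring
      _ ≤ ENNReal.ofReal (t x) ^ 2 * (W x * V x) * (W x * V x * condSq m μ f x) := by gcongr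
      _ = (ENNReal.ofReal (t x) * (W x * V x)) ^ 2 * condSq m μ f x := by ring
      _ ≤ 1 ^ 2 * condSq m μ f x := by gcongr
      _ = condSq m μ f x := by simp
  refine ⟨hzL.toLp, hyL.toLp, ?_, hzL.coeFn_toLp, hyL.coeFn_toLp⟩
  set g : X → ℝ≥0∞ := fun x => ‖finWeight m μ u x‖ₑ ^ 2 with hg
  have hgm : AEMeasurable g μ := (aemeasurable_finWeight hm).enorm.pow_const 2
  have hgfin : ∀ x, g x ≠ ∞ := fun x => by simp only [hg]; finiteness
  have hgc : Conditionable m μ fun x => ((g x).toReal : ℂ) := conditionable_sq_finWeight hm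
  have hgm' : AEMeasurable (fun x => ((g x).toReal : ℂ)) μ :=
    Complex.measurable_ofReal.comp_aemeasurable hgm.ennreal_toReal
  have e1 : (fun x => u x * hzL.toLp _ x) =ᵐ[μ] fun x => ((t x : ℂ) * b x) * ((g x).toReal : ℂ) := by
    filter_upwards [hzL.coeFn_toLp, hb0] with x h1 h2
    rw [h1]
    by_cases hx : V x < ∞
    · have h3 : ((g x).toReal : ℂ) = u x * conj (u x) := by
        have h4 : finWeight m μ u x = u x :=
          Set.indicator_of_mem (show x ∈ {x | condSq m μ u x < ∞} from hx) _
        rw [Complex.mul_conj']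
        simp [hg, h4]
      rw [h3]; ring
    · simp [h2 (not_lt_top_iff.1 hx)]
  refine mem_graph_wct.2 ⟨(hgc.mul hm (htm.mul hbm) hgm').congr e1.symm, ?_⟩
  filter_upwards [hyL.coeFn_toLp, condE_congr (m := m) e1, condE_mul hm (htm.mul hbm) hgm' hgc,
    condSq_finWeight hm (w := u)]
    with x h1 h2 h3 h4
  simp only [Pi.mul_apply] at h3
  have h5 : condE m μ (fun x => ((g x).toReal : ℂ)) x
      = ((condSq m μ (finWeight m μ u) x).toReal : ℂ) := by
    rw [condE_toReal hgfin]
    rfl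
  rw [h1, wctFun, h2, h3, h5, h4]
  by_cases hx : V x < ∞
  · rw [Set.indicator_of_mem (show x ∈ {x | condSq m μ u x < ∞} from hx)]
    ring
  · rw [Set.indicator_of_notMem (show x ∉ {x | condSq m μ u x < ∞} from hx)]
    simp [show V x = ∞ from not_lt_top_iff.1 hx]

/-- `⟪v, t_λ ū E(w̄ f)⟫ = ∫ t_λ conj(E(u v)) E(w̄ f)`. -/
lemma inner_regularised_eq_integral {lam : ℝ} {v z f : Lp ℂ 2 μ}
    (hv : Conditionable m μ fun x => u x * v x)
    (hz : z =ᵐ[μ] fun x => (tFun m μ w u lam x : ℂ) * (conj (u x) * condConj m μ w f x)) :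
    Integrable (fun x => (tFun m μ w u lam x : ℂ) *
      (conj (condE m μ (fun y => u y * v y) x) * condConj m μ w f x)) μ ∧
    ⟪v, z⟫ = ∫ x, (tFun m μ w u lam x : ℂ) *
      (conj (condE m μ (fun y => u y * v y) x) * condConj m μ w f x) ∂μ := by
  set t := tFun m μ w u lam with ht
  set b := condConj m μ w f with hb
  have hφ : Measurable[m] fun x => (t x : ℂ) * b x :=
    (Complex.measurable_ofReal.comp (measurable_tFun m μ w u lam)).mul (measurable_condConj m μ w f)
  have hq : AEMeasurable (fun x => conj (u x * v x)) μ :=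
    Complex.continuous_conj.measurable.comp_aemeasurable (aemeasurable_mul_Lp u v)
  have e1 : (fun x => ⟪v x, z x⟫) =ᵐ[μ] fun x => ((t x : ℂ) * b x) * conj (u x * v x) := by
    filter_upwards [hz] with x hx
    rw [RCLike.inner_apply, hx, map_mul]
    ring
  have hi := (L2.integrable_inner v z).congr e1
  have e2 : condE m μ (fun x => ((t x : ℂ) * b x) * conj (u x * v x)) =ᵐ[μ]
      fun x => (t x : ℂ) * (conj (condE m μ (fun y => u y * v y) x) * b x) := by
    filter_upwards [condE_mul hm hφ hq hv.conj] with x hx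
    rw [hx, condE_conj]
    ring
  refine ⟨(integrable_condE hm hi).congr e2, ?_⟩
  rw [L2.inner_def, integral_congr_ae e1, ← integral_condE hm hi]
  exact integral_congr_ae e2

/-- `u_λ = t_λ ū E(w̄ f)` solves the regularised normal equation. -/
lemma regularised_solves (hW : ∀ᵐ x ∂μ, condSq m μ w x = ∞ → u x = 0)
    {lam : ℝ} (hlam : 0 < lam) {f z y v g : Lp ℂ 2 μ}
    (hz : z =ᵐ[μ] fun x => (tFun m μ w u lam x : ℂ) * (conj (u x) * condConj m μ w f x))
    (hy : y =ᵐ[μ] fun x => w x * ((tFun m μ w u lam x : ℂ) *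
        (((condSq m μ u x).toReal : ℂ) * condConj m μ w f x)))
    (hv : (v, g) ∈ (wct m μ w u).graph) : (lam : ℂ) * ⟪v, z⟫ + ⟪g, y⟫ = ⟪g, f⟫ := by
  obtain ⟨i1, e1⟩ := inner_regularised_eq_integral hm (mem_graph_wct.1 hv).1 hz
  obtain ⟨i2, e2⟩ := inner_wct_eq_integral hm hv y
  obtain ⟨-, e3⟩ := inner_wct_eq_integral hm hv f
  rw [e1, e2, e3, ← integral_const_mul, ← integral_add (i1.const_mul _) i2]
  refine integral_congr_ae ?_
  set t := tFun m μ w u lam with ht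
  set b := condConj m μ w f with hb
  set h : X → ℝ≥0∞ := fun x => ‖finWeight m μ w x‖ₑ ^ 2 with hh
  have hhfin : ∀ x, h x ≠ ∞ := fun x => by simp only [hh]; finiteness
  have hhm : AEMeasurable h μ := (aemeasurable_finWeight hm).enorm.pow_const 2
  have hhm' : AEMeasurable (fun x => ((h x).toReal : ℂ)) μ :=
    Complex.measurable_ofReal.comp_aemeasurable hhm.ennreal_toReal
  have hhc : Conditionable m μ fun x => ((h x).toReal : ℂ) := conditionable_sq_finWeight hm
  have hφ : Measurable[m] fun x => (t x : ℂ) * (((condSq m μ u x).toReal : ℂ) * b x) :=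
    (Complex.measurable_ofReal.comp (measurable_tFun m μ w u lam)).mul
      ((Complex.measurable_ofReal.comp (measurable_condLExp m μ _).ennreal_toReal).mul
        (measurable_condConj m μ w f))
  have e : (fun x => conj (finWeight m μ w x) * y x) =ᵐ[μ] fun x =>
      ((t x : ℂ) * (((condSq m μ u x).toReal : ℂ) * b x)) * ((h x).toReal : ℂ) := by
    filter_upwards [hy] with x hx
    have h1 : ((h x).toReal : ℂ) = conj (finWeight m μ w x) * w x := by
      have : conj (finWeight m μ w x) * w x = conj (finWeight m μ w x) * finWeight m μ w x := by
        by_cases hx : condSq m μ w x < ∞ <;> simp [finWeight, hx]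
      rw [this, Complex.conj_mul']
      simp [hh]
    rw [hx, h1]
    ring
  have hA : MeasurableSet[m] {x | condSq m μ w x = ∞} :=
    measurable_condLExp m μ _ (measurableSet_singleton ∞)
  filter_upwards [condE_congr (m := m) e, condE_mul hm hφ hhm' hhc, condSq_finWeight hm (w := w),
    condSq_eq_zero_of_ae hm hA hW] with x h1 h2 h3 h4
  have h5 : condConj m μ w y x = ((t x : ℂ) * (((condSq m μ u x).toReal : ℂ) * b x)) *
      ((condSq m μ (finWeight m μ w) x).toReal : ℂ) := by
    rw [condConj, h1, h2, condE_toReal hhfin]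
    rfl
  -- Where E(|w|²) = ∞ the cut-off contributes 0, and so does the product, since E(|u|²) = 0 there.
  have h6 : (condSq m μ u x).toReal * (condSq m μ (finWeight m μ w) x).toReal
      = (condSq m μ w x * condSq m μ u x).toReal := by
    rw [h3, ENNReal.toReal_mul, mul_comm]
    by_cases hx : condSq m μ w x < ∞
    · simp [hx]
    · simp [show condSq m μ u x = 0 from h4 (not_lt_top_iff.1 hx)]
  have h7 : (t x : ℂ) * (lam + ((condSq m μ u x).toReal : ℂ) *
      ((condSq m μ (finWeight m μ w) x).toReal : ℂ)) = 1 := by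
    have := tFun_mul_add (m := m) (μ := μ) (w := w) (u := u) hlam x
    rw [← h6] at this
    exact_mod_cast this
  rw [h5]
  -- The integrands agree because t_λ (λ + E(|w|²)E(|u|²)) = 1, multiplied by conj(E(uv)) E(w̄f).
  linear_combination (conj (condE m μ (fun y => u y * v y) x) * b x) * h7

/-- On `D(T*)`, `u_λ = t_λ ū E(w̄ f)` is `t_λ T* f`. -/
lemma regularised_eq_adjoint (hd : Dense ((wct m μ w u).domain : Set (Lp ℂ 2 μ)))
    {lam : ℝ} (hlam : 0 < lam) {f z : Lp ℂ 2 μ}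
    (hz : z =ᵐ[μ] fun x => (tFun m μ w u lam x : ℂ) * (conj (u x) * condConj m μ w f x))
    (hf : f ∈ (wct m μ w u).adjoint.domain) :
    z =ᵐ[μ] fun x => (tFun m μ w u lam x : ℂ) * ((wct m μ w u).adjoint ⟨f, hf⟩ : Lp ℂ 2 μ) x := by
  have htL := memLp_top_tFun (m := m) (μ := μ) (w := w) (u := u) hm hlam
  have ht := measurable_tFun m μ w u lam
  set M := mulL _ htL with hM
  -- M is multiplication by t_λ: it is self-adjoint and commutes with T, so ⟪v, M T*f⟫ = ⟪T(Mv), f⟫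
  -- = ∫ t_λ conj(E(uv)) E(w̄f) = ⟪v, z⟫ for v in the dense domain.
  have key : z = M ((wct m μ w u).adjoint ⟨f, hf⟩) := by
    refine hd.eq_of_inner_right ℂ fun v hv => ?_
    have hg := (wct m μ w u).mem_graph ⟨v, hv⟩
    have hg' := graph_wct_mul hm ht hg (coeFn_mulL htL _) (coeFn_mulL htL _)
    obtain ⟨hMv, hMv'⟩ := graph_mem_iff.1 hg'
    have h1 : ⟪v, M ((wct m μ w u).adjoint ⟨f, hf⟩)⟫ = ⟪M v, (wct m μ w u).adjoint ⟨f, hf⟩⟫ := by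
      rw [L2.inner_def, L2.inner_def]
      refine integral_congr_ae ?_
      filter_upwards [coeFn_mulL htL v, coeFn_mulL htL ((wct m μ w u).adjoint ⟨f, hf⟩)]
        with x h1 h2
      rw [RCLike.inner_apply, RCLike.inner_apply, h1, h2, map_mul, Complex.conj_ofReal]
      ring
    rw [h1, inner_adjoint hd ⟨_, hMv⟩ ⟨f, hf⟩, (inner_regularised_eq_integral hm
      (mem_graph_wct.1 hg).1 hz).2, (inner_wct_eq_integral hm
      ((wct m μ w u).mem_graph ⟨_, hMv⟩) f).2]
    refine (integral_congr_ae ?_).symm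
    have e : (fun x => u x * M v x) =ᵐ[μ] fun x => (tFun m μ w u lam x : ℂ) * (u x * v x) := by
      filter_upwards [coeFn_mulL htL v] with x hx
      rw [hx, mul_left_comm]
    filter_upwards [condE_congr (m := m) e, condE_ofReal_mul hm ht (aemeasurable_mul_Lp u v)]
      with x h1 h2
    rw [h1, h2, map_mul, Complex.conj_ofReal]
    ring
  rw [key]
  exact coeFn_mulL htL _

end Solution

end WCT

end

/-! ### The theorem for M_wEM_u. -/

theorem theorem3p1 {X : Type*} {m m0 : MeasurableSpace X} (hm : m ≤ m0) (μ : Measure[m0] X)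
    [SigmaFinite (μ.trim hm)] (w u : X →ₘ[μ] ℂ)
    (hw : WCT.Conditionable m μ w) (hu : WCT.Conditionable m μ u)
    (T : Lp ℂ 2 μ →ₗ.[ℂ] Lp ℂ 2 μ) (hT : T = WCT.wct m μ w u)
    (hdense : Dense (T.domain : Set (Lp ℂ 2 μ))) (hclosed : T.IsClosed) :
    -- `E(|w|²) E(|u|²)` is finite a.e., so that `t_λ` makes sense
    (∀ᵐ x ∂μ, WCT.condSq m μ w x * WCT.condSq m μ u x < ∞) ∧
    -- `λ I + T* T` and `λ I + T T*` are bijections from their domains onto `L²(μ)`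
    (∀ lam : ℝ, 0 < lam →
      Function.Bijective (WCT.shift lam (WCT.natComp T.adjoint T)).toFun ∧
      Function.Bijective (WCT.shift lam (WCT.natComp T T.adjoint)).toFun) ∧
    -- `T` has exactly one Moore-Penrose inverse
    (∃! S : Lp ℂ 2 μ →ₗ.[ℂ] Lp ℂ 2 μ, WCT.IsMoorePenrose T S) ∧
    ∀ f : Lp ℂ 2 μ, ∃ U : ℝ → Lp ℂ 2 μ,
      (∀ lam : ℝ, 0 < lam →
        -- `u_λ = M_{t_λ} M_{ū} E M_{w̄} f`, which is `M_{t_λ} (T* f)` when `f ∈ D(T*)`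
        (U lam =ᵐ[μ] fun x => (WCT.tFun m μ w u lam x : ℂ) *
          (conj (u x) * WCT.condE m μ (fun y => conj (w y) * f y) x)) ∧
        (∀ hf : f ∈ T.adjoint.domain,
          U lam =ᵐ[μ] fun x => (WCT.tFun m μ w u lam x : ℂ) * (T.adjoint ⟨f, hf⟩ : Lp ℂ 2 μ) x) ∧
        -- `u_λ` is the unique global minimizer
        WCT.IsUniqueMinimizer T f lam (U lam) ∧
        -- `P_λ T* f = u_λ` for `f ∈ D(T*)`, with `P_λ = (λ I + T* T)⁻¹`
        (∀ hf : f ∈ T.adjoint.domain,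
          ((T.adjoint ⟨f, hf⟩, U lam) : Lp ℂ 2 μ × Lp ℂ 2 μ) ∈
            (WCT.shift lam (WCT.natComp T.adjoint T)).inverse.graph) ∧
        -- `T* Q_λ f = u_λ`, with `Q_λ = (λ I + T T*)⁻¹`
        ((f, U lam) : Lp ℂ 2 μ × Lp ℂ 2 μ) ∈
          (WCT.natComp T.adjoint
            (WCT.shift lam (WCT.natComp T T.adjoint)).inverse).graph) ∧
      -- convergence to the minimal-norm solution, which is the value at `f` of the
      -- Moore-Penrose inverse
      (f ∈ WCT.ran T → ∃ y : Lp ℂ 2 μ,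
        WCT.IsMinimalNormSolution T f y ∧
        Tendsto (fun lam => ‖U lam - y‖) (𝓝[>] 0) (𝓝 0) ∧
        ∀ S : Lp ℂ 2 μ →ₗ.[ℂ] Lp ℂ 2 μ, WCT.IsMoorePenrose T S →
          ∃ hf : f ∈ S.domain, S ⟨f, hf⟩ = y) := by
  subst hT
  have hW := WCT.eq_zero_of_condSq_eq_top hm hdense hclosed
  have hN := WCT.condSq_mul_condSq_lt_top hm hdense hclosed
  refine ⟨hN, fun lam hlam => ⟨WCT.bijective_shift_adjoint_comp hdense hclosed hlam,
    WCT.bijective_shift_comp_adjoint hdense hclosed hlam⟩,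
    WCT.existsUnique_isMoorePenrose hclosed, fun f => ?_⟩
  have hex : ∀ lam : ℝ, ∃ x : (WCT.wct m μ w u).domain, 0 < lam →
      WCT.SolvesNormal (WCT.wct m μ w u) lam 0 f x ∧
      ((x : Lp ℂ 2 μ) =ᵐ[μ] fun x => (WCT.tFun m μ w u lam x : ℂ) *
        (conj (u x) * WCT.condConj m μ w f x)) := by
    intro lam
    by_cases hlam : 0 < lam
    · obtain ⟨z, y, hzy, hz, hy⟩ := WCT.exists_regularised_graph hm hN hlam f
      obtain ⟨hzd, rfl⟩ := WCT.graph_mem_iff.1 hzy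
      refine ⟨⟨z, hzd⟩, fun _ => ⟨fun v => ?_, hz⟩⟩
      rw [inner_zero_right, zero_add]
      exact WCT.regularised_solves hm hW hlam hz hy ((WCT.wct m μ w u).mem_graph v)
    -- The value 0 for λ ≤ 0 only makes λ ↦ u_λ total; the limit is taken from the right.
    · exact ⟨0, fun h => absurd h hlam⟩
  choose x hx using hex
  refine ⟨fun lam => x lam, fun lam hlam => ?_, ?_⟩
  · obtain ⟨h1, h2⟩ := hx lam hlam
    refine ⟨?_, WCT.regularised_eq_adjoint hm hdense hlam h2, h1.isUniqueMinimizer hlam,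
      h1.mem_inverse_graph hdense hclosed hlam, h1.mem_adjoint_inverse_graph hdense hclosed hlam⟩
    filter_upwards [h2, WCT.conj_mul_condConj hm hW f] with p h3 h4
    rw [h3, h4]
  -- For f = Tv the minimal-norm solution is the projection of v onto N(T)^⊥, which is also the
  -- value at Tv that `left` prescribes.
  · rintro ⟨v, rfl⟩
    have hmin := WCT.isMinimalNormSolution_starProjection hclosed v
    refine ⟨_, hmin, ?_, fun S hS => hS.left v⟩
    obtain ⟨hy, hTy⟩ := hmin.1
    refine WCT.tendsto_regularised (y := ⟨_, hy⟩) hdense hclosed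
      ((WCT.nul _)ᗮ.starProjection_apply_mem _) fun lam hlam => ?_
    rw [hTy]
    exact (hx lam hlam).1
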